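/- Let $k_\infty=\mathbb F_q((1/T))$, $\pi=1/T$, with $|\pi|=1/q$, let $\mathbb C_\infty$ be the completion of an algebraic closure of $k_\infty$, let $h\ge 0$ be an integer and let $S\subset\mathbb P^1(k_\infty)=k_\infty\cup\{\infty\}$ be open and compact. For $r>0$ put $B_c(r)=\{x\in k_\infty:|x-c|\le r\}$ if $c\in k_\infty$, with local parameter $t_c(x)=x$, and $B_\infty(r)=\{x\in k_\infty:|x|\ge 1/r\}\cup\{\infty\}$, with local parameter $t_\infty(x)=1/x$ (and $1/\infty=0$). Then for every sufficiently large integer $l_0$ the set $S$ is a finite disjoint union $S=\bigsqcup_i B_i$, $B_i=B_{c_i}(|\pi|^{l_0})$. Fix any $l_0\in\mathbb Z$ and any such decomposition. Put $t_i=t_{c_i}$; by a ball of radius $|\pi|^l$ in $S$ ($l\ge l_0$) we mean a set $B=\{x\in B_i:|t_i(x)-a|\le|\pi|^l\}$ with $a\in t_i(B_i)$, and we write $(x-a)^j$ for $(t_i(x)-a)^j$ on $B$. *The space $C^h(S)$.* For a function $g$ on a ball $B\subset k_\infty$ put $\Phi_0g=g$ and $\Phi_n g(x_1,\dots,x_{n+1})=\frac{\Phi_{n-1}g(x_1,x_3,\dots,x_{n+1})-\Phi_{n-1}g(x_2,x_3,\dots,x_{n+1})}{x_1-x_2}$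 on tuples of distinct points of $B$. The function $g$ is $C^h$ on $B$ if $\Phi_hg$ extends to a continuous function $\overline{\Phi_hg}:B^{h+1}\to\mathbb C_\infty$; then $\|g\|_h=\max_{0\le j\le h}\|\overline{\Phi_jg}\|_\infty$ and $D_jg(a)=\overline{\Phi_jg}(a,\dots,a)$ for $j\le h$. $C^h(S)$ is the space of functions $f:S\to\mathbb C_\infty$ whose restriction to each $B_i$, as a function of $t_i$, is $C^h$, with $\|f\|_h=\max_i\|f|_{B_i}\|_h$. *Admissible measures.* Let $P^{(h)}$ be the $\mathbb C_\infty$-span of the functions on $S$ equal to $(x-a)^j$ on a ball with center $a$ and radius $|\pi|^l$ in $S$ and to $0$ elsewhere ($l\ge l_0$, $0\le j\le h$). An $h$-admissible measure on $S$ is a $\mathbb C_\infty$-linear map $\mu:P^{(h)}\to\mathbb C_\infty$, $f\mapsto\int_S f\,d\mu$, for which there is a constant $A$ with $$\Big|\int_{B}(x-a)^j\,d\mu(x)\Big|\le A\,|\pi|^{l(j-h)}$$ for all $0\le j\le h$, all sufficiently large $l$ and all balls $B$ with center $a$ and radius $|\pi|^l$ in $S$. **Theorem.** $(C^h(S),\|\cdot\|_h)$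 is a Banach space over $\mathbb C_\infty$ which contains $P^{(h)}$, and restriction to $P^{(h)}$ is a $\mathbb C_\infty$-linear bijection from the space of continuous linear functionals $C^h(S)\to\mathbb C_\infty$ onto the space of $h$-admissible measures on $S$. If $\mu$ is a continuous linear functional on $C^h(S)$, then for every $f\in C^h(S)$ $$\mu(f)=\lim_{l\to\infty}\ \sum_{B}\ \sum_{j=0}^{h}D_jf(a_{B})\int_{B}(x-a_{B})^j\,d\mu(x),$$ where $B$ runs over the balls of radius $|\pi|^l$ in $S$, for any choice of points $a_{B}\in B$ (the points and the hyperderivatives being taken in the local parameter $t_i$). -/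

import Mathlib

/-- `k_∞ = 𝔽_q((1/T))`: the variable of the Laurent series ring stands for `π = 1/T`. -/
abbrev KInfty (Fq : Type*) [Field Fq] : Type _ := LaurentSeries Fq

namespace KInfty

open WithZero

variable (Fq : Type*) [Field Fq] [Fintype Fq]

/-- The uniformizer `π = 1/T`. -/
noncomputable def unif : KInfty Fq := HahnSeries.single 1 1

theorem one_lt_q : (1 : NNReal) < (Fintype.card Fq : NNReal) := by
  exact_mod_cast Fintype.one_lt_card

/-- The absolute value is normalized by `|x| = q ^ (-v x)`. -/
noncomputable instance rankOne :
    Valuation.RankOne (Valued.v : Valuation (KInfty Fq) (WithZero (Multiplicative ℤ))) where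
  hom' := (WithZeroMulInt.toNNReal (one_lt_q Fq).ne_bot).comp
    MonoidWithZeroHom.ValueGroup₀.embedding
  strictMono' := (WithZeroMulInt.toNNReal_strictMono (one_lt_q Fq)).comp
    MonoidWithZeroHom.ValueGroup₀.embedding_strictMono
  exists_val_nontrivial := by
    refine ⟨unif Fq, ?_⟩
    have h : Valued.v (unif Fq) = exp (-(1 : ℤ)) := LaurentSeries.valuation_single_zpow Fq 1
    rw [h]
    exact ⟨by simp, by simp⟩

noncomputable instance normedField : NontriviallyNormedField (KInfty Fq) :=
  Valued.toNontriviallyNormedField (KInfty Fq) (WithZero (Multiplicative ℤ))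

instance isUltrametricDist : IsUltrametricDist (KInfty Fq) :=
  inferInstanceAs (IsUltrametricDist (KInfty Fq))

instance : CompleteSpace (KInfty Fq) := inferInstance

theorem norm_unif : ‖unif Fq‖ = (Fintype.card Fq : ℝ)⁻¹ := by
  have h : Valued.v (unif Fq) = exp (-(1 : ℤ)) := LaurentSeries.valuation_single_zpow Fq 1
  rw [Valued.toNormedField.norm_def]
  change ((WithZeroMulInt.toNNReal (one_lt_q Fq).ne_bot
    (MonoidWithZeroHom.ValueGroup₀.embedding (Valued.v.restrict (unif Fq))) : NNReal) : ℝ) = _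
  rw [Valuation.embedding_restrict, h, WithZeroMulInt.toNNReal_neg_apply _ exp_ne_zero]
  change (((Fintype.card Fq : NNReal) ^ (-1 : ℤ) : NNReal) : ℝ) = _
  simp

open Valued.integer in
instance properSpace : ProperSpace (KInfty Fq) := by
  refine (properSpace_iff_completeSpace_and_isDiscreteValuationRing_integer_and_finite_residueField
    (K := KInfty Fq) (Γ₀ := WithZero (Multiplicative ℤ))).mpr ?_
  let O := Valued.integer (KInfty Fq)
  let f : PowerSeries Fq →+* O :=
    (HahnSeries.ofPowerSeries ℤ Fq).codRestrict O
      fun F => (LaurentSeries.val_le_one_iff_eq_coe Fq _).mpr ⟨F, rfl⟩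
  have hf : Function.Bijective f := by
    refine ⟨fun x y hxy => HahnSeries.ofPowerSeries_injective (congrArg Subtype.val hxy), ?_⟩
    rintro ⟨x, hx⟩
    obtain ⟨F, hF⟩ := (LaurentSeries.val_le_one_iff_eq_coe Fq x).mp hx
    exact ⟨F, Subtype.ext hF⟩
  let e : PowerSeries Fq ≃+* O := RingEquiv.ofBijective f hf
  refine ⟨inferInstance, IsDiscreteValuationRing.RingEquivClass.isDiscreteValuationRing e, ?_⟩
  have : Finite (IsLocalRing.ResidueField (PowerSeries Fq)) :=
    Finite.of_equiv Fq PowerSeries.residueFieldOfPowerSeries.symm.toEquiv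
  exact Finite.of_equiv _ (IsLocalRing.ResidueField.mapEquiv e).toEquiv

end KInfty

/-- An algebraic closure of `k_∞`, with the unique extension of the absolute value. -/
abbrev KInftyAlg (Fq : Type*) [Field Fq] : Type _ := AlgebraicClosure (KInfty Fq)

namespace KInftyAlg

variable (Fq : Type*) [Field Fq] [Fintype Fq]

noncomputable instance normedField : NormedField (KInftyAlg Fq) :=
  spectralNorm.normedField (KInfty Fq) (KInftyAlg Fq)

noncomputable instance normedAlgebra : NormedAlgebra (KInfty Fq) (KInftyAlg Fq) :=
  spectralNorm.normedAlgebra (KInfty Fq) (KInftyAlg Fq)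

instance isUltrametricDist : IsUltrametricDist (KInftyAlg Fq) :=
  IsUltrametricDist.of_normedAlgebra (KInfty Fq)

instance completableTopField : CompletableTopField (KInftyAlg Fq) :=
  letI : Valued (KInftyAlg Fq) NNReal := NormedField.toValued
  inferInstance

end KInftyAlg

/-- `ℂ_∞`, the completion of an algebraic closure of `k_∞`. -/
abbrev CInfty (Fq : Type*) [Field Fq] [Fintype Fq] : Type _ :=
  UniformSpace.Completion (KInftyAlg Fq)

/-! ### Difference quotients -/

/-- The `n`-th order difference quotient `Φ_n g`, given by `Φ_0 g = g` and
`Φ_{n+1} g (x_0, x_1, x_2, …) =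
(Φ_n g (x_0, x_2, …) - Φ_n g (x_1, x_2, …)) / (x_0 - x_1)`. -/
noncomputable def divDiff {K C : Type*} [Field K] [AddCommGroup C] [Module K C] (g : K → C) :
    (n : ℕ) → (Fin (n + 1) → K) → C
  | 0, x => g (x 0)
  | n + 1, x => (x 0 - x 1)⁻¹ •
      (divDiff g n (fun i => x (Fin.succAbove 1 i)) - divDiff g n (fun i => x (Fin.succ i)))

/-- The tuples of `n` pairwise distinct points of `B`. -/
def distinctTuples {K : Type*} (B : Set K) (n : ℕ) : Set (Fin n → K) :=
  {x | (∀ i, x i ∈ B) ∧ Function.Injective x}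

section
variable {K C : Type*}

theorem divDiff_add [Field K] [AddCommGroup C] [Module K C] (f g : K → C) (n : ℕ) (x : Fin (n + 1) → K) :
    divDiff (f + g) n x = divDiff f n x + divDiff g n x := by
  induction n with
  | zero => rfl
  | succ n ih => simp only [divDiff, ih, ← smul_add]; congr 1; abel

theorem divDiff_smul [Field K] {R : Type*} [Semiring R] [AddCommGroup C] [Module K C] [Module R C] [SMulCommClass K R C]
    (a : R) (g : K → C) (n : ℕ) (x : Fin (n + 1) → K) :
    divDiff (a • g) n x = a • divDiff g n x := by
  induction n with
  | zero => rfl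
  | succ n ih => simp only [divDiff, ih, ← smul_sub]; exact smul_comm _ _ _

theorem divDiff_eq_sum [Field K] [AddCommGroup C] [Module K C] (g : K → C) (n : ℕ)
    (x : Fin (n + 1) → K) (hx : Function.Injective x) :
    divDiff g n x = ∑ i, (∏ k, if k = i then 1 else x i - x k)⁻¹ • g (x i) := by
  induction n with
  | zero => simp [divDiff]
  | succ n ih =>
    have h01 : x 0 - x 1 ≠ 0 := sub_ne_zero.mpr (hx.ne (by simp))
    have e1 : ∀ k : Fin n, Fin.succAbove (1 : Fin (n + 2)) k.succ = k.succ.succ := by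
      intro k
      have : (1 : Fin (n + 2)) = Fin.succ 0 := rfl
      rw [this, Fin.succ_succAbove_succ]; simp
    rw [divDiff, ih (fun i => x (Fin.succAbove 1 i)) (hx.comp Fin.succAbove_right_injective),
      ih (fun i => x (Fin.succ i)) (hx.comp (Fin.succ_injective _))]
    simp only [Fin.sum_univ_succ, Fin.prod_univ_succ, e1, smul_sub, smul_add, Finset.smul_sum,
      smul_smul]
    have e2 : ∀ k : Fin n, (0 : Fin (n + 2)) ≠ k.succ.succ := fun k => (Fin.succ_ne_zero _).symm
    simp [Fin.succ_ne_zero, (Fin.succ_ne_zero _).symm]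
    have key : ∀ i : Fin n, ∀ P : K, (x 0 - x 1)⁻¹ * (P⁻¹ * (x i.succ.succ - x 0)⁻¹) -
      (x 0 - x 1)⁻¹ * (P⁻¹ * (x i.succ.succ - x 1)⁻¹) =
        P⁻¹ * (x i.succ.succ - x 1)⁻¹ * (x i.succ.succ - x 0)⁻¹ := by
      intro i P
      have h0 : x i.succ.succ - x 0 ≠ 0 := sub_ne_zero.mpr (hx.ne (Fin.succ_ne_zero _))
      have h1 : x i.succ.succ - x 1 ≠ 0 := sub_ne_zero.mpr (hx.ne (by
        rw [show (1 : Fin (n + 2)) = Fin.succ 0 from rfl]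
        exact fun h => Fin.succ_ne_zero _ (Fin.succ_injective _ h)))
      have : (x 0 - x 1)⁻¹ * (P⁻¹ * (x i.succ.succ - x 0)⁻¹) -
      (x 0 - x 1)⁻¹ * (P⁻¹ * (x i.succ.succ - x 1)⁻¹) = P⁻¹ * ((x 0 - x 1)⁻¹ * ((x i.succ.succ - x 0)⁻¹ - (x i.succ.succ - x 1)⁻¹)) := by ring
      rw [this, mul_assoc]
      congr 1
      field_simp
      ring
    have e3 : ∀ k : Fin n, k.succ.succ ≠ (1 : Fin (n + 2)) := fun k h =>
      Fin.succ_ne_zero _ (Fin.succ_injective _ (h.trans (show (1 : Fin (n + 2)) = Fin.succ 0 from rfl)))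
    have e4 : (x 1 - x 0)⁻¹ = -(x 0 - x 1)⁻¹ := by rw [← neg_sub, inv_neg]
    simp only [e3, (e3 _).symm, if_false, ← key, sub_smul, Finset.sum_sub_distrib, e4, mul_neg,
      neg_smul]
    rw [mul_comm (x 0 - x 1)⁻¹, mul_comm (x 0 - x 1)⁻¹]
    abel

theorem divDiff_perm [Field K] [AddCommGroup C] [Module K C] (g : K → C) (n : ℕ)
    (x : Fin (n + 1) → K) (hx : Function.Injective x) (σ : Equiv.Perm (Fin (n + 1))) :
    divDiff g n (fun i => x (σ i)) = divDiff g n x := by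
  rw [divDiff_eq_sum g n (fun i => x (σ i)) (hx.comp σ.injective), divDiff_eq_sum g n x hx]
  refine Fintype.sum_equiv σ _ _ fun i => ?_
  congr 2
  exact Fintype.prod_equiv σ _ _ fun k => by simp

theorem norm_divDiff_sub_update_le [NormedField K] [SeminormedAddCommGroup C] [NormedSpace K C]
    (g : K → C) (n : ℕ) {B : Set K} {M R : ℝ} (hR : ∀ a ∈ B, ∀ b ∈ B, ‖a - b‖ ≤ R)
    (hM : ∀ x ∈ distinctTuples B (n + 2), ‖divDiff g (n + 1) x‖ ≤ M)
    {x : Fin (n + 1) → K} (hx : x ∈ distinctTuples B (n + 1)) (i : Fin (n + 1)) {b : K}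
    (hb : b ∈ B) (hbx : ∀ k, x k ≠ b) :
    ‖divDiff g n x - divDiff g n (Function.update x i b)‖ ≤ R * M := by
  have hu : Function.Injective (Function.update x i b) := by
    intro k l hkl
    by_cases hk : k = i <;> by_cases hl : l = i
    · rw [hk, hl]
    · subst hk; simp [Function.update_of_ne hl] at hkl; exact absurd hkl.symm (hbx l)
    · subst hl; simp [Function.update_of_ne hk] at hkl; exact absurd hkl (hbx k)
    · simp only [Function.update_of_ne hk, Function.update_of_ne hl] at hkl
      exact hx.2 hkl
  let σ := Equiv.swap 0 i
  let y : Fin (n + 1) → K := fun k => x (σ k)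
  have hy : Function.Injective y := hx.2.comp σ.injective
  let X : Fin (n + 2) → K := Fin.cons (y 0) (Fin.cons b (fun k => y k.succ))
  have hX : X ∈ distinctTuples B (n + 2) := by
    refine ⟨?_, ?_⟩
    · intro k
      refine Fin.cases ?_ (fun k => Fin.cases ?_ (fun k => ?_) k) k
      · exact hx.1 _
      · exact hb
      · exact hx.1 _
    · simp only [X, Fin.cons_injective_iff]
      refine ⟨?_, ?_, hy.comp (Fin.succ_injective _)⟩
      · rintro ⟨k, hk⟩
        revert hk
        refine Fin.cases ?_ (fun k => ?_) k
        · exact fun h => hbx _ h.symm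
        · exact fun h => Fin.succ_ne_zero _ (hy h)
      · rintro ⟨k, hk⟩
        exact hbx _ hk
  have h1 : (fun k => X (Fin.succAbove 1 k)) = y := by
    funext k
    refine Fin.cases ?_ (fun k => ?_) k
    · rfl
    · have : (1 : Fin (n + 2)) = Fin.succ 0 := rfl
      rw [this, Fin.succ_succAbove_succ]
      simp [X]
  have h2 : (fun k => X (Fin.succ k)) = fun k => Function.update x i b (σ k) := by
    funext k
    refine Fin.cases ?_ (fun k => ?_) k
    · simp [X, σ]
    · simp only [X, Fin.cons_succ, y]
      rw [Function.update_of_ne]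
      intro h
      have : σ k.succ = σ 0 := by rw [h]; simp [σ]
      exact Fin.succ_ne_zero _ (σ.injective this)
  have h3 : X 0 - X 1 ≠ 0 := sub_ne_zero.mpr (hX.2.ne (by simp))
  have key : divDiff g n x - divDiff g n (Function.update x i b)
      = (X 0 - X 1) • divDiff g (n + 1) X := by
    rw [divDiff, smul_inv_smul₀ h3, h1, h2, divDiff_perm g n _ hu σ, divDiff_perm g n x hx.2 σ]
  rw [key, norm_smul]
  have := hM X hX
  exact mul_le_mul (hR _ (hX.1 0) _ (hX.1 1)) this (norm_nonneg _)
    ((norm_nonneg _).trans (hR _ (hX.1 0) _ (hX.1 1)))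

theorem exists_bound_divDiff [NormedField K] [SeminormedAddCommGroup C] [NormedSpace K C]
    (g : K → C) (n : ℕ) {B : Set K} {M R : ℝ} (hR : ∀ a ∈ B, ∀ b ∈ B, ‖a - b‖ ≤ R)
    (hM : ∀ x ∈ distinctTuples B (n + 2), ‖divDiff g (n + 1) x‖ ≤ M) :
    ∃ M', ∀ x ∈ distinctTuples B (n + 1), ‖divDiff g n x‖ ≤ M' := by
  classical
  obtain ⟨F, hFB, hF⟩ : ∃ F : Finset K, (F : Set K) ⊆ B ∧ (B ⊆ F ∨ n + 2 ≤ F.card) := by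
    by_cases hB : B.Finite
    · exact ⟨hB.toFinset, by simp, Or.inl (by simp)⟩
    · obtain ⟨F, hF, hc⟩ := Set.Infinite.exists_subset_card_eq hB (n + 2)
      exact ⟨F, hF, Or.inr hc.ge⟩
  have hfin : (Set.univ.pi fun _ : Fin (n + 1) => (F : Set K)).Finite :=
    Set.Finite.pi fun _ => F.finite_toSet
  obtain ⟨M0, hM0⟩ := (hfin.image fun x => ‖divDiff g n x‖).bddAbove
  have step : ∀ m : ℕ, ∀ x ∈ distinctTuples B (n + 1),
      (Finset.univ.filter fun i => x i ∉ F).card ≤ m →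
        ‖divDiff g n x‖ ≤ M0 + m * |R * M| := by
    intro m
    induction m with
    | zero =>
      intro x hx hm
      have hx' : ∀ i, x i ∈ F := by simpa [Finset.filter_eq_empty_iff] using hm
      simpa using hM0 ⟨x, fun i _ => hx' i, rfl⟩
    | succ m ih =>
      intro x hx hm
      by_cases hall : ∀ i, x i ∈ F
      · refine (ih x hx (by simp [hall])).trans ?_
        push_cast
        nlinarith [abs_nonneg (R * M)]
      push Not at hall
      obtain ⟨i, hi⟩ := hall
      obtain ⟨b, hbF, hbx⟩ : ∃ b ∈ F, ∀ k, x k ≠ b := by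
        rcases hF with hF | hF
        · exact absurd (hF (hx.1 i)) hi
        · have : ¬ F ⊆ Finset.univ.image x := fun h => by
            have h1 := Finset.card_le_card h
            have h2 : (Finset.univ.image x).card ≤ n + 1 := by
              simpa using Finset.card_image_le (s := Finset.univ) (f := x)
            omega
          obtain ⟨b, hb, hb'⟩ := Finset.not_subset.mp this
          exact ⟨b, hb, fun k hk => hb' (Finset.mem_image.mpr ⟨k, Finset.mem_univ _, hk⟩)⟩
      have hle := norm_divDiff_sub_update_le g n hR hM hx i (hFB hbF) hbx
      have hu : Function.update x i b ∈ distinctTuples B (n + 1) := by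
        refine ⟨fun k => ?_, fun k l hkl => ?_⟩
        · by_cases hk : k = i
          · subst hk; simpa using hFB hbF
          · simpa [Function.update_of_ne hk] using hx.1 k
        · by_cases hk : k = i <;> by_cases hl : l = i
          · rw [hk, hl]
          · subst hk; simp [Function.update_of_ne hl] at hkl; exact absurd hkl.symm (hbx l)
          · subst hl; simp [Function.update_of_ne hk] at hkl; exact absurd hkl (hbx k)
          · simp only [Function.update_of_ne hk, Function.update_of_ne hl] at hkl
            exact hx.2 hkl
      have hcard : (Finset.univ.filter fun k => Function.update x i b k ∉ F).card ≤ m := by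
        have : (Finset.univ.filter fun k => Function.update x i b k ∉ F)
            ⊂ Finset.univ.filter fun k => x k ∉ F := by
          refine Finset.ssubset_iff_subset_ne.mpr ⟨fun k hk => ?_, fun h => ?_⟩
          · simp only [Finset.mem_filter, Finset.mem_univ, true_and] at hk ⊢
            by_cases hki : k = i
            · subst hki; exact hi
            · rwa [Function.update_of_ne hki] at hk
          · have : i ∈ Finset.univ.filter fun k => x k ∉ F := by simpa using hi
            rw [← h] at this
            simp [hbF] at this
        have := Finset.card_lt_card this
        omega
      have h3 := ih _ hu hcard
      have h4 : ‖divDiff g n x‖ ≤ ‖divDiff g n x - divDiff g n (Function.update x i b)‖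
          + ‖divDiff g n (Function.update x i b)‖ := by
        simpa using norm_add_le (divDiff g n x - divDiff g n (Function.update x i b))
          (divDiff g n (Function.update x i b))
      push_cast
      nlinarith [le_abs_self (R * M)]
  exact ⟨_, fun x hx => step _ x hx (Finset.card_le_univ _)⟩

end

/-! ### Functions of class `C^n` on a subset of `K` -/

/-- `g` is of class `C^n` on `B`: its `n`-th order difference quotient, defined on the tuples of
`n + 1` distinct points of `B`, extends to a continuous function on `B ^ (n + 1)`. -/
def IsCn {K C : Type*} [NormedField K] [NormedAddCommGroup C] [NormedSpace K C]
    (n : ℕ) (B : Set K) (g : K → C) : Prop :=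
  ∃ G : (Fin (n + 1) → K) → C, ContinuousOn G (Set.univ.pi fun _ => B) ∧
    ∀ x ∈ distinctTuples B (n + 1), G x = divDiff g n x

/-- The hyperderivative `D_j g (a)`: the value at `(a, …, a)` of the extension by continuity of the
`j`-th order difference quotient of `g` on `B`. -/
noncomputable def hyperDeriv {K C : Type*} [NormedField K] [NormedAddCommGroup C] [NormedSpace K C]
    (j : ℕ) (B : Set K) (g : K → C) (a : K) : C :=
  extendFrom (distinctTuples B (j + 1)) (divDiff g j) (fun _ => a)

/-- The norm `max_{j ≤ n} ‖Φ_j g‖_∞` on `C^n(B)`. The supremum of (the continuous extension of) the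
difference quotient is taken over the dense set of tuples of distinct points. -/
noncomputable def cnNorm {K C : Type*} [NormedField K] [NormedAddCommGroup C] [NormedSpace K C]
    (n : ℕ) (B : Set K) (g : K → C) : ℝ :=
  ⨆ j : Fin (n + 1), ⨆ x : distinctTuples B (j + 1), ‖divDiff g j x.1‖

section
variable {K C : Type*} [NormedField K] [NormedAddCommGroup C] [NormedSpace K C]
  {n : ℕ} {B : Set K} {f g : K → C}

theorem IsCn.bound (hB : IsCompact B) (hg : IsCn n B g) (j : ℕ) (hj : j ≤ n) :
    ∃ M, ∀ x ∈ distinctTuples B (j + 1), ‖divDiff g j x‖ ≤ M := by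
  obtain ⟨R, hR⟩ := hB.isBounded.exists_norm_le
  have hR' : ∀ a ∈ B, ∀ b ∈ B, ‖a - b‖ ≤ R + R := fun a ha b hb =>
    (norm_sub_le a b).trans (add_le_add (hR a ha) (hR b hb))
  induction hj using Nat.decreasingInduction with
  | self =>
    obtain ⟨G, hG, hGx⟩ := hg
    obtain ⟨M, hM⟩ := (isCompact_univ_pi fun _ : Fin (n + 1) => hB).exists_bound_of_continuousOn hG
    exact ⟨M, fun x hx => by rw [← hGx x hx]; exact hM x fun i _ => hx.1 i⟩
  | of_succ k hk ih =>
    obtain ⟨M, hM⟩ := ih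
    exact exists_bound_divDiff g k hR' hM

theorem IsCn.bddAbove (hB : IsCompact B) (hg : IsCn n B g) (j : Fin (n + 1)) :
    BddAbove (Set.range fun x : distinctTuples B (j + 1) => ‖divDiff g j x.1‖) := by
  obtain ⟨M, hM⟩ := hg.bound hB j (Nat.le_of_lt_succ j.2)
  exact ⟨M, by rintro _ ⟨x, rfl⟩; exact hM x.1 x.2⟩

theorem IsCn.norm_le_cnNorm (hB : IsCompact B) (hg : IsCn n B g) (j : Fin (n + 1))
    (x : distinctTuples B (j + 1)) : ‖divDiff g j x.1‖ ≤ cnNorm n B g :=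
  (le_ciSup (hg.bddAbove hB j) x).trans
    (le_ciSup (f := fun j : Fin (n + 1) => ⨆ x : distinctTuples B (j + 1), ‖divDiff g j x.1‖)
      (Set.finite_range _).bddAbove j)

theorem cnNorm_nonneg : 0 ≤ cnNorm n B g :=
  Real.iSup_nonneg fun _ => Real.iSup_nonneg fun _ => norm_nonneg _

theorem cnNorm_le {M : ℝ} (hM : 0 ≤ M)
    (h : ∀ j : Fin (n + 1), ∀ x : distinctTuples B (j + 1), ‖divDiff g j x.1‖ ≤ M) :
    cnNorm n B g ≤ M :=
  Real.iSup_le (fun j => Real.iSup_le (h j) hM) hM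

theorem IsCn.zero : IsCn n B (0 : K → C) := by
  refine ⟨0, continuousOn_const, fun x _ => ?_⟩
  have := divDiff_smul (0 : ℤ) (0 : K → C) n x
  simpa using this.symm

theorem IsCn.add (hf : IsCn n B f) (hg : IsCn n B g) : IsCn n B (f + g) := by
  obtain ⟨F, hF, hFx⟩ := hf
  obtain ⟨G, hG, hGx⟩ := hg
  exact ⟨F + G, hF.add hG, fun x hx => by
    rw [divDiff_add, ← hFx x hx, ← hGx x hx]; rfl⟩

end

section
variable {K C : Type*} [NormedField K] [NormedField C] [NormedAlgebra K C]
  {n : ℕ} {B : Set K} {f g : K → C}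

theorem IsCn.smul (a : C) (hf : IsCn n B f) : IsCn n B (a • f) := by
  obtain ⟨F, hF, hFx⟩ := hf
  exact ⟨a • F, hF.const_smul a, fun x hx => by
    rw [divDiff_smul, ← hFx x hx]; rfl⟩

end

/-! ### Closed balls of the projective line `OnePoint K` -/

section
variable {K : Type*} [NormedField K]

/-- The closed ball of radius `r` of the projective line with center `c`: the usual one if
`c ∈ K`, and `{x : |x| ≥ 1 / r} ∪ {∞}` if `c = ∞`. -/
def projBall (c : OnePoint K) (r : ℝ) : Set (OnePoint K) :=
  c.elim {x | ∀ t : K, x = t → 1 ≤ r * ‖t‖} (fun a => {x | ∃ t : K, x = t ∧ ‖t - a‖ ≤ r})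

/-- The value of the local parameter at the center `c` of a ball. -/
def centerCoord (c : OnePoint K) : K := c.elim 0 id

open Classical in
/-- The inverse of the local parameter of a ball with center `c`: `t ↦ t` if `c ∈ K`, and
`t ↦ 1 / t` if `c = ∞`. -/
noncomputable def localParam (c : OnePoint K) (t : K) : OnePoint K :=
  c.elim (if t = 0 then OnePoint.infty else ((t⁻¹ : K) : OnePoint K)) (fun _ => (t : OnePoint K))

/-- The local parameter of a ball with center `c`: `x ↦ x` if `c ∈ K`, and `x ↦ 1 / x` (with
`1 / ∞ = 0`) if `c = ∞`. -/
noncomputable def localCoord (c x : OnePoint K) : K :=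
  c.elim (x.elim 0 fun t => t⁻¹) (fun _ => x.elim 0 id)

theorem localCoord_spec {c x : OnePoint K} {r : ℝ} (hr : 0 ≤ r) (hx : x ∈ projBall c r) :
    localCoord c x ∈ Metric.closedBall (centerCoord c) r ∧ localParam c (localCoord c x) = x := by
  induction c using OnePoint.rec with
  | infty =>
    induction x using OnePoint.rec with
    | infty => simp [localCoord, localParam, centerCoord, hr]
    | coe t =>
      have h : 1 ≤ r * ‖t‖ := hx t rfl
      have ht : t ≠ 0 := by rintro rfl; norm_num at h
      refine ⟨?_, by simp [localCoord, localParam, ht]⟩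
      simpa [localCoord, centerCoord] using (inv_le_iff_one_le_mul₀ (norm_pos_iff.mpr ht)).mpr h
  | coe a =>
    obtain ⟨t, rfl, ht⟩ := hx
    exact ⟨by simpa [localCoord, centerCoord, dist_eq_norm] using ht, rfl⟩

end

/-- A decomposition of `S` as a finite disjoint union of closed balls of radius `|π| ^ l₀`,
given by the centers of the balls. -/
structure BallDecomposition {K : Type*} [NormedField K] (π : K) (l₀ : ℤ) (S : Set (OnePoint K)) where
  centers : Finset (OnePoint K)
  disjoint : (centers : Set (OnePoint K)).PairwiseDisjoint fun c => projBall c (‖π‖ ^ l₀)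
  union_eq : ⋃ c ∈ centers, projBall c (‖π‖ ^ l₀) = S

namespace BallDecomposition

section
variable {K : Type*} [NormedField K] {π : K} {l₀ : ℤ} {S : Set (OnePoint K)}
  (D : BallDecomposition π l₀ S)

/-- The ball of the decomposition with center `c`, seen in its local parameter. -/
def piece (_D : BallDecomposition π l₀ S) (c : OnePoint K) : Set K :=
  Metric.closedBall (centerCoord c) (‖π‖ ^ l₀)

open Classical in
/-- A function on `S`, near the center `c`, as a function of the local parameter. -/
noncomputable def localRep {C : Type*} [Zero C] (_D : BallDecomposition π l₀ S) (f : S → C)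
    (c : OnePoint K) : K → C :=
  fun t => if ht : localParam c t ∈ S then f ⟨localParam c t, ht⟩ else 0

end

section
variable {K C : Type*} [NormedField K] [Ring C] {π : K} {l₀ : ℤ}
  {S : Set (OnePoint K)} (D : BallDecomposition π l₀ S)

theorem localRep_add (f g : S → C) (c : OnePoint K) :
    D.localRep (f + g) c = D.localRep f c + D.localRep g c := by
  funext t; by_cases h : localParam c t ∈ S <;> simp [localRep, h]

theorem localRep_smul (a : C) (f : S → C) (c : OnePoint K) :
    D.localRep (a • f) c = a • D.localRep f c := by
  funext t; by_cases h : localParam c t ∈ S <;> simp [localRep, h]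

theorem localRep_zero (c : OnePoint K) : D.localRep (0 : S → C) c = 0 := by
  funext t; by_cases h : localParam c t ∈ S <;> simp [localRep, h]

end

section
variable {K C : Type*} [NormedField K] [NormedField C] [NormedAlgebra K C] {π : K} {l₀ : ℤ}
  {S : Set (OnePoint K)} (D : BallDecomposition π l₀ S)

variable (C) in
/-- The functions of class `C^n` on `S`: those which are of class `C^n` on each ball of the
decomposition, with respect to the local parameter of the ball. -/
noncomputable def cnFunctions (n : ℕ) : Submodule C (S → C) where
  carrier := {f | ∀ c ∈ D.centers, IsCn n (D.piece c) (D.localRep f c)}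
  add_mem' hf hg c hc := by rw [localRep_add]; exact (hf c hc).add (hg c hc)
  zero_mem' c _ := by rw [localRep_zero]; exact IsCn.zero
  smul_mem' a f hf c hc := by rw [localRep_smul]; exact (hf c hc).smul a

variable (C) in
/-- The space `C^n(S)`, which carries the norm `‖·‖_n` (and not the topology of pointwise
convergence). -/
def CnSpace (n : ℕ) : Type _ := D.cnFunctions C n

namespace CnSpace

variable {D} {n : ℕ}

noncomputable instance : AddCommGroup (D.CnSpace C n) :=
  inferInstanceAs (AddCommGroup (D.cnFunctions C n))

noncomputable instance : Module C (D.CnSpace C n) :=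
  inferInstanceAs (Module C (D.cnFunctions C n))

/-- The inclusion of `C^n(S)` in the space of all functions on `S`. -/
def toFun (f : D.CnSpace C n) : S → C := Subtype.val f

/-- An element of `C^n(S)`, from the underlying function. -/
def mk (f : S → C) (hf : f ∈ D.cnFunctions C n) : D.CnSpace C n := ⟨f, hf⟩

theorem toFun_injective : Function.Injective (toFun : D.CnSpace C n → S → C) :=
  Subtype.val_injective

theorem toFun_add (f g : D.CnSpace C n) : (f + g).toFun = f.toFun + g.toFun := rfl

theorem toFun_smul (a : C) (f : D.CnSpace C n) : (a • f).toFun = a • f.toFun := rfl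

theorem toFun_zero : (0 : D.CnSpace C n).toFun = 0 := rfl

theorem isCn (f : D.CnSpace C n) {c : OnePoint K} (hc : c ∈ D.centers) :
    IsCn n (D.piece c) (D.localRep f.toFun c) := f.2 c hc

/-- `‖f‖_n` is the largest of the norms of the restrictions of `f` to the balls of the
decomposition. -/
noncomputable instance : Norm (D.CnSpace C n) where
  norm f := ⨆ c : D.centers, cnNorm n (D.piece c.1) (D.localRep f.toFun c.1)

theorem norm_def (f : D.CnSpace C n) :
    ‖f‖ = ⨆ c : D.centers, cnNorm n (D.piece c.1) (D.localRep f.toFun c.1) := rfl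

theorem norm_divDiff_le [ProperSpace K] (f : D.CnSpace C n) (c : D.centers) (j : Fin (n + 1))
    (x : distinctTuples (D.piece c.1) (j + 1)) :
    ‖divDiff (D.localRep f.toFun c.1) j x.1‖ ≤ ‖f‖ :=
  ((f.isCn c.2).norm_le_cnNorm (isCompact_closedBall _ _) j x).trans
    (le_ciSup (f := fun c : D.centers => cnNorm n (D.piece c.1) (D.localRep f.toFun c.1))
      (Set.finite_range _).bddAbove c)

theorem norm_nonneg' (f : D.CnSpace C n) : 0 ≤ ‖f‖ := Real.iSup_nonneg fun _ => cnNorm_nonneg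

theorem norm_le_of_forall {f : D.CnSpace C n} {M : ℝ} (hM : 0 ≤ M)
    (h : ∀ (c : D.centers) (j : Fin (n + 1)) (x : distinctTuples (D.piece c.1) (j + 1)),
      ‖divDiff (D.localRep f.toFun c.1) j x.1‖ ≤ M) : ‖f‖ ≤ M :=
  Real.iSup_le (fun c => cnNorm_le hM (h c)) hM

theorem norm_smul_le' [ProperSpace K] (a : C) (f : D.CnSpace C n) : ‖a • f‖ ≤ ‖a‖ * ‖f‖ :=
  norm_le_of_forall (mul_nonneg (norm_nonneg _) f.norm_nonneg') fun c j x => by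
    rw [toFun_smul, localRep_smul, divDiff_smul, norm_smul]
    exact mul_le_mul_of_nonneg_left (f.norm_divDiff_le c j x) (norm_nonneg _)

theorem core [ProperSpace K] : NormedSpace.Core C (D.CnSpace C n) where
  norm_nonneg := norm_nonneg'
  norm_smul a f := by
    refine (norm_smul_le' a f).antisymm ?_
    by_cases ha : a = 0
    · subst ha; simpa using norm_nonneg' _
    · have h := norm_smul_le' a⁻¹ (a • f)
      rw [inv_smul_smul₀ ha, norm_inv] at h
      exact (le_inv_mul_iff₀ (norm_pos_iff.mpr ha)).mp h
  norm_triangle f g :=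
    norm_le_of_forall (add_nonneg f.norm_nonneg' g.norm_nonneg') fun c j x => by
      rw [toFun_add, localRep_add, divDiff_add]
      exact (norm_add_le _ _).trans
        (add_le_add (f.norm_divDiff_le c j x) (g.norm_divDiff_le c j x))
  norm_eq_zero_iff f := by
    constructor
    · intro hf
      apply toFun_injective
      funext ⟨x, hx⟩
      have hx' := hx
      rw [← D.union_eq] at hx'
      simp only [Set.mem_iUnion, exists_prop] at hx'
      obtain ⟨c, hc, hxc⟩ := hx'
      obtain ⟨h1, h2⟩ := localCoord_spec (zpow_nonneg (norm_nonneg π) l₀) hxc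
      have h3 := f.norm_divDiff_le ⟨c, hc⟩ 0
        ⟨fun _ => localCoord c x, fun _ => h1, fun i j _ => Subsingleton.elim (α := Fin 1) i j⟩
      rw [hf] at h3
      have h4 : divDiff (D.localRep f.toFun c) 0 (fun _ => localCoord c x) = f.toFun ⟨x, hx⟩ := by
        have hmem : localParam c (localCoord c x) ∈ S := h2.symm ▸ hx
        simp only [divDiff, localRep, dif_pos hmem]
        exact congrArg f.toFun (Subtype.ext h2)
      exact (h4.symm.trans (norm_le_zero_iff.mp h3))
    · rintro rfl
      refine le_antisymm (norm_le_of_forall le_rfl fun c j x => ?_) (norm_nonneg' _)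
      have := divDiff_smul (0 : C) (0 : K → C) j x.1
      rw [toFun_zero, localRep_zero]
      simpa using this

noncomputable instance [ProperSpace K] : NormedAddCommGroup (D.CnSpace C n) :=
  NormedAddCommGroup.ofCore core

noncomputable instance [ProperSpace K] : NormedSpace C (D.CnSpace C n) :=
  NormedSpace.ofCore core

end CnSpace

end

/-! ### Admissible measures -/

section
variable {K C : Type*} [NormedField K] [NormedField C] [NormedAlgebra K C] {π : K} {l₀ : ℤ}
  {S : Set (OnePoint K)}

open Classical in
/-- The function on `S` equal to `(x - a) ^ j` on the ball of radius `|π| ^ l` around `a`, and to `0`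
elsewhere. Here `a`, the ball and the factor `x - a` are all expressed in the local parameter of
the ball of the decomposition with center `c` (so `x` is replaced by `1 / x` if `c = ∞`). -/
noncomputable def localMonomial (_D : BallDecomposition π l₀ S) (c : OnePoint K) (a : K) (l : ℤ)
    (j : ℕ) : S → C :=
  fun x => if x.1 ∈ localParam c '' Metric.closedBall a (‖π‖ ^ l)
    then algebraMap K C ((localCoord c x.1 - a) ^ j) else 0

variable (D : BallDecomposition π l₀ S)

variable (C) in
/-- The space `P^{(h)}` of locally polynomial functions of degree at most `h` on `S`. -/
noncomputable def locPoly (h : ℕ) : Submodule C (S → C) :=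
  Submodule.span C {f | ∃ c ∈ D.centers, ∃ a ∈ D.piece c, ∃ l : ℤ, l₀ ≤ l ∧ ∃ j ≤ h,
    f = D.localMonomial c a l j}

open Classical in
/-- The integral `∫_S f dμ` of a function in `P^{(h)}` (and `0` for other functions). -/
noncomputable def integral {h : ℕ} (μ : Module.Dual C (D.locPoly C h)) (f : S → C) : C :=
  if hf : f ∈ D.locPoly C h then μ ⟨f, hf⟩ else 0

theorem integral_add {h : ℕ} (μ ν : Module.Dual C (D.locPoly C h)) (f : S → C) :
    D.integral (μ + ν) f = D.integral μ f + D.integral ν f := by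
  by_cases hf : f ∈ D.locPoly C h <;> simp [integral, hf]

theorem integral_smul {h : ℕ} (a : C) (μ : Module.Dual C (D.locPoly C h)) (f : S → C) :
    D.integral (a • μ) f = a * D.integral μ f := by
  by_cases hf : f ∈ D.locPoly C h <;> simp [integral, hf]

theorem integral_zero {h : ℕ} (f : S → C) :
    D.integral (0 : Module.Dual C (D.locPoly C h)) f = 0 := by
  by_cases hf : f ∈ D.locPoly C h <;> simp [integral, hf]

variable (C) in
/-- The space of `h`-admissible measures on `S`: the linear functionals on `P^{(h)}` with
`|∫_{B_a(|π| ^ l)} (x - a) ^ j dμ(x)| ≤ A |π| ^ (l (j - h))` for a constant `A`, all `j ≤ h`, all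
sufficiently large `l` and all balls of radius `|π| ^ l` contained in `S`. -/
noncomputable def admissibleMeasures (h : ℕ) : Submodule C (Module.Dual C (D.locPoly C h)) where
  carrier := {μ | ∃ A : ℝ, ∃ L : ℤ, ∀ l : ℤ, l₀ ≤ l → L ≤ l → ∀ c ∈ D.centers, ∀ a ∈ D.piece c,
    ∀ j ≤ h, ‖D.integral μ (D.localMonomial c a l j)‖ ≤ A * ‖π‖ ^ (l * ((j : ℤ) - h))}
  add_mem' := by
    rintro μ ν ⟨A, L, hμ⟩ ⟨A', L', hν⟩
    refine ⟨A + A', max L L', fun l hl hL c hc a ha j hj => ?_⟩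
    rw [integral_add, add_mul]
    exact (norm_add_le _ _).trans (add_le_add
      (hμ l hl (le_of_max_le_left hL) c hc a ha j hj)
      (hν l hl (le_of_max_le_right hL) c hc a ha j hj))
  zero_mem' := ⟨0, 0, fun l _ _ c _ a _ j _ => by simp [integral_zero]⟩
  smul_mem' := by
    rintro b μ ⟨A, L, hμ⟩
    refine ⟨‖b‖ * A, L, fun l hl hL c hc a ha j hj => ?_⟩
    rw [integral_smul, norm_mul, mul_assoc]
    exact mul_le_mul_of_nonneg_left (hμ l hl hL c hc a ha j hj) (norm_nonneg _)

/-- `T` selects one point in every ball of radius `|π| ^ l` contained in `S`; the points in the ball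
of the decomposition with center `c` are given by their local parameters `T c`. -/
def IsSample (l : ℤ) (T : OnePoint K → Finset K) : Prop :=
  ∀ c ∈ D.centers, (∀ a ∈ T c, a ∈ D.piece c) ∧
    ∀ t ∈ D.piece c, ∃! a, a ∈ T c ∧ t ∈ Metric.closedBall a (‖π‖ ^ l)

/-- The Riemann sum `∑_i ∑_{j ≤ h} D_j f(a_i) ∫_{B_i} (x - a_i) ^ j dμ(x)` over the balls `B_i` of
radius `|π| ^ l` contained in `S`, where the `a_i ∈ B_i` are the points selected by `T`. -/
noncomputable def riemannSum {h : ℕ} (l : ℤ) (T : OnePoint K → Finset K) (f : S → C)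
    (μ : Module.Dual C (D.locPoly C h)) : C :=
  ∑ c ∈ D.centers, ∑ a ∈ T c, ∑ j ∈ Finset.range (h + 1),
    hyperDeriv j (D.piece c) (D.localRep f c) a * D.integral μ (D.localMonomial c a l j)

end

end BallDecomposition

open Filter Topology Metric

/-! The duality rests on two facts: $P^{(h)}$ is dense in $C^h(S)$, and admissibility of a measure
is the same as boundedness on $P^{(h)}$ for $\|\cdot\|_h$. Extension by continuity then gives the
bijection. A Riemann sum of level $l$ is the integral of the piecewise Taylor polynomial $T_lf$ of
degree $h$, so its limit is $\mu(f)$ because $T_lf\to f$ in $C^h(S)$.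

Density. On a ball of radius $r$ around $a$, all hyperderivatives of order at most $h$ of the Taylor
error vanish at $a$, and its quotient $\Phi_h$ is small, say at most $\varepsilon$, by uniform
continuity. A bound for $\Phi_{i+1}$ is a Lipschitz constant for $\Phi_i$, so descending from order
$h$ gives $|\Phi_i|\le\varepsilon r^{h-i}$ (`norm_divDiff_sub_taylorSum_le`). Tuples spread over
several balls obey the same bound: by symmetry a difference quotient with two nodes more than $r$
apart is a difference of quotients of lower order divided by something larger than $r$
(`norm_divDiff_le_of_close`). As $r\le1$, the error has norm at most $\varepsilon$.

Continuous implies admissible. The same two estimates show that the monomial of degree $j$ cut off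
to a ball of radius $r\le1$ has norm at most $r^{j-h}$, which is the growth allowed by
admissibility.

Admissible implies bounded (`exists_norm_le_of_mem_admissibleMeasures`). For $p\in P^{(h)}$,
$\mu(T_{l+1}p)-\mu(T_lp)$ is the Riemann sum of level $l+1$ of $p-T_lp$. With $r=|\pi|^l$, the
$j$-th hyperderivatives are at most $\|p\|_hr^{h-j}$ and the integrals at most $A(|\pi|r)^{j-h}$, so
each product is at most $A|\pi|^{-h}\|p\|_h$, whatever $l$ is. The absolute value is nonarchimedean,
so these differences do not accumulate, and $T_lp=p$ for large $l$.

Completeness comes from a Cauchy criterion for the class $C^h$ (`isCn_iff_forall_norm_sub_le`),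
which passes to uniform limits of difference quotients. Decompositions of $S$ exist because $S$ is
compact and two balls of equal radius in $k_\infty$ are equal or disjoint. -/

theorem IsUltrametricDist.norm_sub_le_max {E : Type*} [SeminormedAddCommGroup E]
    [IsUltrametricDist E] (x y : E) : ‖x - y‖ ≤ max ‖x‖ ‖y‖ := by
  rw [sub_eq_add_neg, ← norm_neg y]
  exact IsUltrametricDist.norm_add_le_max x (-y)

/-! ### Algebra of difference quotients, and propagation of bounds from close to arbitrary nodes. -/

section
variable {K C : Type*}

theorem divDiff_congr [Field K] [AddCommGroup C] [Module K C] {f g : K → C} {B : Set K}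
    (hfg : ∀ t ∈ B, f t = g t) (n : ℕ) (x : Fin (n + 1) → K) (hx : ∀ i, x i ∈ B) :
    divDiff f n x = divDiff g n x := by
  induction n with
  | zero => exact hfg _ (hx 0)
  | succ n ih => simp only [divDiff]; rw [ih _ fun i => hx _, ih _ fun i => hx _]

theorem divDiff_zero_fun [Field K] [AddCommGroup C] [Module K C] (n : ℕ) (x : Fin (n + 1) → K) :
    divDiff (0 : K → C) n x = 0 := by
  simpa using divDiff_smul (0 : ℤ) (0 : K → C) n x

theorem divDiff_sub [Field K] [AddCommGroup C] [Module K C] (f g : K → C) (n : ℕ)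
    (x : Fin (n + 1) → K) : divDiff (f - g) n x = divDiff f n x - divDiff g n x := by
  have h := divDiff_add (f - g) g n x
  rw [sub_add_cancel] at h
  exact eq_sub_of_add_eq h.symm

theorem divDiff_sum [Field K] [AddCommGroup C] [Module K C] {ι : Type*} (s : Finset ι)
    (f : ι → K → C) (n : ℕ) (x : Fin (n + 1) → K) :
    divDiff (∑ i ∈ s, f i) n x = ∑ i ∈ s, divDiff (f i) n x := by
  classical
  induction s using Finset.induction_on with
  | empty => simpa using divDiff_zero_fun n x
  | insert i s hi ih => rw [Finset.sum_insert hi, divDiff_add, ih, Finset.sum_insert hi]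

/-- The product rule for difference quotients, for a linear factor. -/
theorem divDiff_sub_smul [Field K] [AddCommGroup C] [Module K C] (g : K → C) (a : K) (n : ℕ)
    (x : Fin (n + 2) → K) (hx : Function.Injective x) :
    divDiff (fun t => (t - a) • g t) (n + 1) x =
      (x 0 - a) • divDiff g (n + 1) x + divDiff g n fun i => x i.succ := by
  induction n with
  | zero =>
    have h01 : x 0 - x 1 ≠ 0 := sub_ne_zero.mpr (hx.ne (by simp))
    have e : (Fin.succAbove (1 : Fin 2) 0) = 0 := rfl
    have e' : (Fin.succ (0 : Fin 1)) = 1 := rfl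
    simp only [divDiff, e, e']
    have : (x 1 - a) • g (x 1) = (x 0 - a) • g (x 1) - (x 0 - x 1) • g (x 1) := by
      rw [← sub_smul]; congr 1; ring
    rw [this, smul_sub, smul_sub, smul_sub, smul_smul _ (x 0 - x 1), inv_mul_cancel₀ h01, one_smul,
      ← sub_add, smul_comm (x 0 - x 1)⁻¹ (x 0 - a) (g (x 0)),
      smul_comm (x 0 - x 1)⁻¹ (x 0 - a) (g (x 1)), smul_sub]
  | succ n ih =>
    have h01 : x 0 - x 1 ≠ 0 := sub_ne_zero.mpr (hx.ne (by simp))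
    rw [divDiff, ih (fun i => x (Fin.succAbove 1 i)) (hx.comp Fin.succAbove_right_injective),
      ih (fun i => x i.succ) (hx.comp (Fin.succ_injective _))]
    have e0 : (Fin.succAbove (1 : Fin (n + 3)) 0) = 0 := rfl
    have e1 : ∀ k : Fin (n + 1), Fin.succAbove (1 : Fin (n + 3)) k.succ = k.succ.succ := by
      intro k
      have : (1 : Fin (n + 3)) = Fin.succ 0 := rfl
      rw [this, Fin.succ_succAbove_succ]; simp
    have e2 : (Fin.succ (0 : Fin (n + 2))) = 1 := rfl
    simp only [e0, e1, e2]
    rw [show divDiff g (n + 1 + 1) x = (x 0 - x 1)⁻¹ •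
      (divDiff g (n + 1) (fun i => x (Fin.succAbove 1 i)) -
        divDiff g (n + 1) (fun i => x (Fin.succ i))) from rfl, add_sub_add_right_eq_sub]
    generalize divDiff g (n + 1) (fun i => x (Fin.succAbove 1 i)) = u
    generalize divDiff g (n + 1) (fun i => x (Fin.succ i)) = v
    have : (x 1 - a) • v = (x 0 - a) • v - (x 0 - x 1) • v := by
      rw [← sub_smul]; congr 1; ring
    rw [this, ← sub_add, ← smul_sub, smul_add, smul_smul _ (x 0 - x 1), inv_mul_cancel₀ h01,
      one_smul, smul_comm]

theorem update_mem_distinctTuples {B : Set K} {n : ℕ} {x : Fin n → K}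
    (hx : x ∈ distinctTuples B n) (i : Fin n) {b : K} (hb : b ∈ B) (hbx : ∀ k, x k ≠ b) :
    Function.update x i b ∈ distinctTuples B n := by
  refine ⟨fun k => ?_, fun k l hkl => ?_⟩
  · by_cases hk : k = i
    · subst hk; simpa using hb
    · simpa [Function.update_of_ne hk] using hx.1 k
  · by_cases hk : k = i <;> by_cases hl : l = i
    · rw [hk, hl]
    · subst hk; simp [Function.update_of_ne hl] at hkl; exact absurd hkl.symm (hbx l)
    · subst hl; simp [Function.update_of_ne hk] at hkl; exact absurd hkl (hbx k)
    · simp only [Function.update_of_ne hk, Function.update_of_ne hl] at hkl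
      exact hx.2 hkl

/-- Replacing one node of a difference quotient. -/
theorem exists_divDiff_sub_update_eq [Field K] [AddCommGroup C] [Module K C] (g : K → C) (n : ℕ)
    {B : Set K} {x : Fin (n + 1) → K} (hx : x ∈ distinctTuples B (n + 1)) (i : Fin (n + 1)) {b : K}
    (hb : b ∈ B) (hbx : ∀ k, x k ≠ b) :
    ∃ X ∈ distinctTuples B (n + 2), divDiff g n x - divDiff g n (Function.update x i b) =
      (x i - b) • divDiff g (n + 1) X := by
  have hu := (update_mem_distinctTuples hx i hb hbx).2
  let σ := Equiv.swap 0 i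
  let y : Fin (n + 1) → K := fun k => x (σ k)
  have hy : Function.Injective y := hx.2.comp σ.injective
  let X : Fin (n + 2) → K := Fin.cons (y 0) (Fin.cons b (fun k => y k.succ))
  have hX : X ∈ distinctTuples B (n + 2) := by
    refine ⟨?_, ?_⟩
    · intro k
      refine Fin.cases ?_ (fun k => Fin.cases ?_ (fun k => ?_) k) k
      · exact hx.1 _
      · exact hb
      · exact hx.1 _
    · simp only [X, Fin.cons_injective_iff]
      refine ⟨?_, ?_, hy.comp (Fin.succ_injective _)⟩
      · rintro ⟨k, hk⟩
        revert hk
        refine Fin.cases ?_ (fun k => ?_) k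
        · exact fun h => hbx _ h.symm
        · exact fun h => Fin.succ_ne_zero _ (hy h)
      · rintro ⟨k, hk⟩
        exact hbx _ hk
  have h1 : (fun k => X (Fin.succAbove 1 k)) = y := by
    funext k
    refine Fin.cases ?_ (fun k => ?_) k
    · rfl
    · have : (1 : Fin (n + 2)) = Fin.succ 0 := rfl
      rw [this, Fin.succ_succAbove_succ]
      simp [X]
  have h2 : (fun k => X (Fin.succ k)) = fun k => Function.update x i b (σ k) := by
    funext k
    refine Fin.cases ?_ (fun k => ?_) k
    · simp [X, σ]
    · simp only [X, Fin.cons_succ, y]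
      rw [Function.update_of_ne]
      intro h
      have : σ k.succ = σ 0 := by rw [h]; simp [σ]
      exact Fin.succ_ne_zero _ (σ.injective this)
  have h3 : X 0 - X 1 ≠ 0 := sub_ne_zero.mpr (hX.2.ne (by simp))
  refine ⟨X, hX, ?_⟩
  have h4 : x i - b = X 0 - X 1 := by
    change _ = x (Equiv.swap 0 i 0) - b
    rw [Equiv.swap_apply_left]
  rw [h4, divDiff, smul_inv_smul₀ h3, h1, h2, divDiff_perm g n _ hu σ, divDiff_perm g n x hx.2 σ]

/-- A bound for the difference quotients at tuples of close points, up to order `N`, gives a bound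
at all tuples. -/
theorem norm_divDiff_le_of_close [NormedField K] [SeminormedAddCommGroup C] [NormedSpace K C]
    [IsUltrametricDist C] (g : K → C) {B : Set K} {r M : ℝ} (hr : 0 < r) (N : ℕ)
    (hM : ∀ i ≤ N, ∀ x ∈ distinctTuples B (i + 1), (∀ k m, ‖x k - x m‖ ≤ r) →
      ‖divDiff g i x‖ ≤ M / r ^ i) :
    ∀ i ≤ N, ∀ x ∈ distinctTuples B (i + 1), ‖divDiff g i x‖ ≤ M / r ^ i := by
  intro i
  induction i with
  | zero =>
    intro hi x hx
    refine hM 0 hi x hx fun k m => ?_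
    rw [Subsingleton.elim (α := Fin 1) k m]; simpa using hr.le
  | succ i ih =>
    intro hi x hx
    by_cases hc : ∀ k m, ‖x k - x m‖ ≤ r
    · exact hM _ hi x hx hc
    push Not at hc
    obtain ⟨k, m, hkm⟩ := hc
    have hne : k ≠ m := by rintro rfl; simp at hkm; linarith
    -- Difference quotients are symmetric, so the two distant nodes may be moved to the first two
    -- places, where their difference is the denominator in the recursion.
    obtain ⟨σ, h0, h1⟩ : ∃ σ : Equiv.Perm (Fin (i + 2)), σ 0 = k ∧ σ 1 = m := by
      refine ⟨Equiv.swap k (Equiv.swap 0 k 0) * Equiv.swap 0 k *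
        Equiv.swap 1 ((Equiv.swap 0 k) m), ?_, ?_⟩
      · have : (Equiv.swap 1 ((Equiv.swap 0 k) m)) (0 : Fin (i + 2)) = 0 := by
          apply Equiv.swap_apply_of_ne_of_ne
          · simp
          · intro h
            have := congrArg (Equiv.swap 0 k) h
            simp at this
            exact hne this
        simp [this]
      · simp
    rw [← divDiff_perm g (i + 1) x hx.2 σ, divDiff, norm_smul, norm_inv, h0, h1]
    have hd : ∀ f : Fin (i + 1) → Fin (i + 2), Function.Injective f →
        ‖divDiff g i fun t => x (σ (f t))‖ ≤ M / r ^ i := fun f hf =>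
      ih (by omega) _ ⟨fun t => hx.1 _, hx.2.comp (σ.injective.comp hf)⟩
    have h2 := (IsUltrametricDist.norm_sub_le_max _ _).trans (max_le (hd _ (Fin.succAbove_right_injective (p := 1)))
      (hd _ (Fin.succ_injective _)))
    calc _ ≤ r⁻¹ * (M / r ^ i) := by
          refine mul_le_mul ?_ h2 (norm_nonneg _) (by positivity)
          exact inv_anti₀ hr hkm.le
      _ = M / r ^ (i + 1) := by rw [pow_succ]; field_simp

/-- Balls are infinite, so nodes can be perturbed into general position. This serves both for the
density of the tuples of distinct points and for avoiding coincidences when nodes are exchanged. -/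
theorem exists_injective_near [NontriviallyNormedField K] (n : ℕ) (x : Fin n → K) (F : Finset K)
    {δ : ℝ} (hδ : 0 < δ) :
    ∃ z : Fin n → K, Function.Injective z ∧ ∀ k, ‖z k - x k‖ ≤ δ ∧ z k ∉ F := by
  classical
  induction n with
  | zero => exact ⟨x, fun i => i.elim0, fun i => i.elim0⟩
  | succ n ih =>
    obtain ⟨z, hz, hz'⟩ := ih fun k => x k.succ
    obtain ⟨b, hb, hbF⟩ := (infinite_of_mem_nhds (x 0)
      (closedBall_mem_nhds (x 0) hδ)).exists_notMem_finset (F ∪ Finset.univ.image z)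
    simp only [Finset.mem_union, Finset.mem_image, Finset.mem_univ, true_and, not_or] at hbF
    refine ⟨Fin.cons b z, Fin.cons_injective_iff.mpr ⟨hbF.2, hz⟩, fun k => ?_⟩
    refine Fin.cases ?_ (fun k => ?_) k
    · exact ⟨by simpa [dist_eq_norm] using hb, hbF.1⟩
    · exact hz' k

end

/-! ### Lipschitz estimates for difference quotients and the Cauchy criterion for the class $C^n$.
-/

section
variable {K C : Type*} [NontriviallyNormedField K] [IsUltrametricDist K]
  [NormedAddCommGroup C] [NormedSpace K C]

theorem mem_closedBall_of_norm_sub_le {a t s : K} {r δ : ℝ} (ht : t ∈ closedBall a r) (hδ : δ ≤ r)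
    (hs : ‖s - t‖ ≤ δ) : s ∈ closedBall a r := by
  rw [mem_closedBall, dist_eq_norm] at *
  calc ‖s - a‖ = ‖(s - t) + (t - a)‖ := by congr 1; ring
    _ ≤ r := (IsUltrametricDist.norm_add_le_max _ _).trans (max_le (hs.trans hδ) ht)

theorem norm_sub_le_of_mem_closedBall {a t s : K} {r : ℝ} (hs : s ∈ closedBall a r)
    (ht : t ∈ closedBall a r) : ‖s - t‖ ≤ r := by
  rw [mem_closedBall, dist_eq_norm] at *
  calc ‖s - t‖ = ‖(s - a) - (t - a)‖ := by congr 1; ring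
    _ ≤ r := (IsUltrametricDist.norm_sub_le_max _ _).trans (max_le hs ht)

theorem closedBall_subset_of_mem {a b : K} {r s : ℝ} (hb : b ∈ closedBall a r) (hs : s ≤ r) :
    closedBall b s ⊆ closedBall a r := fun t ht =>
  mem_closedBall_of_norm_sub_le hb hs (by simpa [dist_eq_norm] using ht)

/-- This makes limits of difference quotients unique, hence `extendFrom` meaningful, at tuples with
repeated entries. -/
theorem mem_closure_distinctTuples {a : K} {r : ℝ} (hr : 0 < r) (n : ℕ) {x : Fin n → K}
    (hx : ∀ i, x i ∈ closedBall a r) : x ∈ closure (distinctTuples (closedBall a r) n) := by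
  rw [Metric.mem_closure_iff]
  intro ε hε
  obtain ⟨z, hz, hz'⟩ := exists_injective_near n x ∅ (lt_min (half_pos hε) hr)
  refine ⟨z, ⟨fun i => mem_closedBall_of_norm_sub_le (hx i) (min_le_right _ _) (hz' i).1, hz⟩, ?_⟩
  refine lt_of_le_of_lt ((dist_pi_le_iff (half_pos hε).le).mpr fun i => ?_) (half_lt_self hε)
  rw [dist_comm, dist_eq_norm]
  exact (hz' i).1.trans (min_le_left _ _)

theorem nhdsWithin_distinctTuples_neBot {a : K} {r : ℝ} (hr : 0 < r) (n : ℕ) {x : Fin n → K}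
    (hx : ∀ i, x i ∈ closedBall a r) : (𝓝[distinctTuples (closedBall a r) n] x).NeBot :=
  mem_closure_iff_nhdsWithin_neBot.mp (mem_closure_distinctTuples hr n hx)

/-- A bound for the difference quotient of order `n + 1` is a Lipschitz constant for the one of
order `n`. -/
theorem norm_divDiff_sub_le [IsUltrametricDist C] (g : K → C) (n : ℕ) {a : K} {r δ M : ℝ}
    (hr : 0 < r) (hδ : 0 < δ)
    (hM : ∀ x ∈ distinctTuples (closedBall a r) (n + 2), ‖divDiff g (n + 1) x‖ ≤ M)
    {x y : Fin (n + 1) → K} (hx : x ∈ distinctTuples (closedBall a r) (n + 1))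
    (hy : y ∈ distinctTuples (closedBall a r) (n + 1)) (hxy : ∀ k, ‖x k - y k‖ ≤ δ) :
    ‖divDiff g n x - divDiff g n y‖ ≤ δ * M := by
  classical
  have hM0 : 0 ≤ M := by
    obtain ⟨z, hz, hz'⟩ := exists_injective_near (n + 2) (fun _ => a) ∅ hr
    exact (norm_nonneg _).trans
      (hM z ⟨fun i => by simpa [dist_eq_norm] using (hz' i).1, hz⟩)
  -- Nodes of `x` are exchanged for those of `z` one at a time, each exchange costing one quotient
  -- of order `n + 1` times a node difference. If `x` and `z` share no node, all intermediate tuples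
  -- remain distinct; the ultrametric inequality keeps the total at a single $\delta M$.
  have key : ∀ x z : Fin (n + 1) → K, x ∈ distinctTuples (closedBall a r) (n + 1) →
      z ∈ distinctTuples (closedBall a r) (n + 1) → (∀ k m, x k ≠ z m) →
      (∀ k, ‖x k - z k‖ ≤ δ) → ‖divDiff g n x - divDiff g n z‖ ≤ δ * M := by
    intro x z hx hz hne hxz
    have step : ∀ s : Finset (Fin (n + 1)),
        s.piecewise z x ∈ distinctTuples (closedBall a r) (n + 1) ∧
        ‖divDiff g n x - divDiff g n (s.piecewise z x)‖ ≤ δ * M := by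
      intro s
      induction s using Finset.induction_on with
      | empty => exact ⟨by simpa using hx, by simpa using mul_nonneg hδ.le hM0⟩
      | insert i s hi ih =>
        rw [Finset.piecewise_insert]
        have hw : ∀ k, s.piecewise z x k ≠ z i := by
          intro k
          by_cases hk : k ∈ s
          · rw [Finset.piecewise_eq_of_mem _ _ _ hk]
            exact fun h => hi (hz.2 h ▸ hk)
          · rw [Finset.piecewise_eq_of_notMem _ _ _ hk]; exact hne _ _
        refine ⟨update_mem_distinctTuples ih.1 i (hz.1 i) hw, ?_⟩
        obtain ⟨X, hX, hXe⟩ := exists_divDiff_sub_update_eq g n ih.1 i (hz.1 i) hw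
        rw [← sub_add_sub_cancel, hXe, Finset.piecewise_eq_of_notMem _ _ _ hi]
        refine (IsUltrametricDist.norm_add_le_max _ _).trans (max_le ih.2 ?_)
        rw [norm_smul]
        exact mul_le_mul (hxz i) (hM X hX) (norm_nonneg _) hδ.le
    simpa using (step Finset.univ).2
  -- In general `x` and `y` may share nodes; both are compared with a third tuple that avoids them.
  obtain ⟨z, hz, hz'⟩ := exists_injective_near (n + 1) x
    (Finset.univ.image x ∪ Finset.univ.image y) (lt_min hδ hr)
  have hzB : z ∈ distinctTuples (closedBall a r) (n + 1) :=
    ⟨fun i => mem_closedBall_of_norm_sub_le (hx.1 i) (min_le_right _ _) (hz' i).1, hz⟩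
  have hn : ∀ k m, x k ≠ z m ∧ y k ≠ z m := by
    intro k m
    have := (hz' m).2
    simp only [Finset.mem_union, Finset.mem_image, Finset.mem_univ, true_and, not_or,
      not_exists] at this
    exact ⟨this.1 k, this.2 k⟩
  have hxz : ∀ k, ‖x k - z k‖ ≤ δ := fun k => by
    rw [norm_sub_rev]; exact (hz' k).1.trans (min_le_left _ _)
  have h1 := key x z hx hzB (fun k m => (hn k m).1) hxz
  have h2 := key y z hy hzB (fun k m => (hn k m).2) fun k => by
    rw [← sub_add_sub_cancel _ (x k) _]
    exact (IsUltrametricDist.norm_add_le_max _ _).trans (max_le (by rw [norm_sub_rev]; exact hxy k) (hxz k))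
  calc _ = ‖(divDiff g n x - divDiff g n z) - (divDiff g n y - divDiff g n z)‖ := by congr 1; abel
    _ ≤ δ * M := (IsUltrametricDist.norm_sub_le_max _ _).trans (max_le h1 h2)

/-- The Cauchy criterion for functions of class `C^n`. -/
theorem isCn_iff_forall_norm_sub_le [CompleteSpace C] (g : K → C) (n : ℕ) {a : K} {r : ℝ}
    (hr : 0 < r) :
    IsCn n (closedBall a r) g ↔ ∀ x : Fin (n + 1) → K, (∀ i, x i ∈ closedBall a r) → ∀ ε > 0,
      ∃ δ > 0, ∀ y ∈ distinctTuples (closedBall a r) (n + 1),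
        ∀ z ∈ distinctTuples (closedBall a r) (n + 1), dist y x < δ → dist z x < δ →
          ‖divDiff g n y - divDiff g n z‖ ≤ ε := by
  constructor
  · rintro ⟨G, hG, hGx⟩ x hx ε hε
    obtain ⟨δ, hδ, h⟩ := Metric.continuousOn_iff.mp hG x (fun i _ => hx i) (ε / 2) (half_pos hε)
    refine ⟨δ, hδ, fun y hy z hz hyx hzx => ?_⟩
    have h1 := h y (fun i _ => hy.1 i) hyx
    have h2 := h z (fun i _ => hz.1 i) hzx
    rw [hGx y hy] at h1
    rw [hGx z hz] at h2
    rw [← dist_eq_norm]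
    linarith [dist_triangle_right (divDiff g n y) (divDiff g n z) (G x)]
  · intro h
    have hlim : ∀ x ∈ Set.univ.pi fun _ : Fin (n + 1) => closedBall a r,
        ∃ y, Tendsto (divDiff g n) (𝓝[distinctTuples (closedBall a r) (n + 1)] x) (𝓝 y) := by
      intro x hx
      have hx' : ∀ i, x i ∈ closedBall a r := fun i => hx i trivial
      have := nhdsWithin_distinctTuples_neBot hr (n + 1) hx'
      rw [← cauchy_map_iff_exists_tendsto, Metric.cauchy_iff]
      refine ⟨inferInstance, fun ε hε => ?_⟩
      obtain ⟨δ, hδ, hd⟩ := h x hx' (ε / 2) (half_pos hε)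
      refine ⟨divDiff g n '' (distinctTuples (closedBall a r) (n + 1) ∩ ball x δ),
        image_mem_map (inter_mem_nhdsWithin _ (ball_mem_nhds x hδ)), ?_⟩
      rintro _ ⟨y, hy, rfl⟩ _ ⟨z, hz, rfl⟩
      rw [dist_eq_norm]
      exact (hd y hy.1 z hz.1 hy.2 hz.2).trans_lt (half_lt_self hε)
    refine ⟨extendFrom (distinctTuples (closedBall a r) (n + 1)) (divDiff g n),
      continuousOn_extendFrom (fun x hx => mem_closure_distinctTuples hr _ fun i => hx i trivial)
        hlim, fun x hx => ?_⟩
    obtain ⟨y, hy⟩ := hlim x fun i _ => hx.1 i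
    rw [extendFrom_eq (subset_closure hx) hy]
    -- A tuple of distinct points lies in the domain of the quotient itself, so the limit there can
    -- only be the value.
    exact tendsto_nhds_unique (hy.mono_left (pure_le_nhdsWithin hx))
      ((tendsto_pure_pure _ _).mono_right (pure_le_nhds _))

end

/-! ### Hyperderivatives as limits of difference quotients. -/

section
variable {K C : Type*} [NontriviallyNormedField K] [NormedAddCommGroup C] [NormedSpace K C]
  {n j : ℕ} {B : Set K} {f g : K → C} {a : K} {r : ℝ} {d e : C}

/-- `d` is the limit at `(a, …, a)` of the `j`-th order difference quotient of `g` on `B`. -/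
def HasHyperDeriv (j : ℕ) (B : Set K) (g : K → C) (a : K) (d : C) : Prop :=
  Tendsto (divDiff g j) (𝓝[distinctTuples B (j + 1)] fun _ => a) (𝓝 d)

theorem HasHyperDeriv.add (hf : HasHyperDeriv j B f a d) (hg : HasHyperDeriv j B g a e) :
    HasHyperDeriv j B (f + g) a (d + e) :=
  (Tendsto.add hf hg).congr fun x => (divDiff_add f g j x).symm

theorem HasHyperDeriv.sub (hf : HasHyperDeriv j B f a d) (hg : HasHyperDeriv j B g a e) :
    HasHyperDeriv j B (f - g) a (d - e) :=
  (Tendsto.sub hf hg).congr fun x => (divDiff_sub f g j x).symm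

theorem HasHyperDeriv.sum {ι : Type*} {s : Finset ι} {f : ι → K → C} {d : ι → C}
    (h : ∀ i ∈ s, HasHyperDeriv j B (f i) a (d i)) :
    HasHyperDeriv j B (∑ i ∈ s, f i) a (∑ i ∈ s, d i) :=
  (tendsto_finsetSum s h).congr fun x => (divDiff_sum s f j x).symm

theorem HasHyperDeriv.mono {B' : Set K} (h : HasHyperDeriv j B g a d) (hB : B' ⊆ B) :
    HasHyperDeriv j B' g a d :=
  h.mono_left (nhdsWithin_mono _ fun _ hx => ⟨fun i => hB (hx.1 i), hx.2⟩)

/-- Tuples in `B` close to $(a,\dots,a)$ already lie in the small ball, so only the germ at `a`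
matters. Hyperderivatives can thus be read off from a polynomial that agrees with the function near
`a`. -/
theorem HasHyperDeriv.congr_of_closedBall (hr : 0 < r)
    (h : HasHyperDeriv j (closedBall a r) f a d) (hfg : ∀ t ∈ closedBall a r, f t = g t) :
    HasHyperDeriv j B g a d := by
  have hm : {x : Fin (j + 1) → K | ∀ i, x i ∈ closedBall a r} ∈ 𝓝 fun _ : Fin (j + 1) => a := by
    refine eventually_all.mpr fun i => ?_
    exact (continuous_apply i).continuousAt.preimage_mem_nhds (closedBall_mem_nhds a hr)
  have hle : 𝓝[distinctTuples B (j + 1)] (fun _ : Fin (j + 1) => a) ≤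
      𝓝[distinctTuples (closedBall a r) (j + 1)] (fun _ => a) := by
    rw [nhdsWithin_le_iff]
    filter_upwards [self_mem_nhdsWithin, mem_nhdsWithin_of_mem_nhds hm] with x hx hx'
    exact ⟨hx', hx.2⟩
  refine (h.congr' ?_).mono_left hle
  filter_upwards [self_mem_nhdsWithin] with x hx
  exact divDiff_congr hfg j x hx.1

end

section
variable {K C : Type*} [NontriviallyNormedField K] [IsUltrametricDist K]
  [NormedAddCommGroup C] [NormedSpace K C] {n j : ℕ} {g : K → C} {a b : K} {r : ℝ} {d : C}

/-- The bound makes the quotient of order `n` Lipschitz, hence Cauchy at every tuple. This replaces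
any explicit extension, both for cut-off monomials and for passing from $C^n$ to lower orders. -/
theorem isCn_of_norm_divDiff_succ_le [IsUltrametricDist C] [CompleteSpace C] {M : ℝ} (hr : 0 < r)
    (hM : ∀ x ∈ distinctTuples (closedBall a r) (n + 2), ‖divDiff g (n + 1) x‖ ≤ M) :
    IsCn n (closedBall a r) g := by
  rw [isCn_iff_forall_norm_sub_le g n hr]
  intro x _ ε hε
  -- Two tuples within this distance of `x` have nodes at most twice as far apart; `|M| + 1` is used
  -- as the Lipschitz constant because it is positive.
  have hδ : 0 < ε / (2 * (|M| + 1)) := by positivity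
  refine ⟨_, hδ, fun y hy z hz hyx hzx => ?_⟩
  refine (norm_divDiff_sub_le g n hr (mul_pos two_pos hδ) (fun x hx => (hM x hx).trans
    ((le_abs_self M).trans (le_add_of_nonneg_right zero_le_one))) hy hz fun k => ?_).trans ?_
  · rw [← dist_eq_norm]
    have h1 := (dist_le_pi_dist y x k).trans hyx.le
    have h2 := (dist_le_pi_dist z x k).trans hzx.le
    linarith [dist_triangle_right (y k) (z k) (x k)]
  · apply le_of_eq
    field_simp

theorem IsCn.of_le [ProperSpace K] [IsUltrametricDist C] [CompleteSpace C] (hr : 0 < r)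
    (hg : IsCn n (closedBall a r) g) (hj : j ≤ n) : IsCn j (closedBall a r) g := by
  rcases hj.eq_or_lt with rfl | hj
  · exact hg
  · obtain ⟨M, hM⟩ := hg.bound (isCompact_closedBall _ _) (j + 1) hj
    exact isCn_of_norm_divDiff_succ_le hr hM

theorem HasHyperDeriv.hyperDeriv_eq (hr : 0 < r) (ha : a ∈ closedBall b r)
    (h : HasHyperDeriv j (closedBall b r) g a d) : hyperDeriv j (closedBall b r) g a = d :=
  extendFrom_eq (mem_closure_distinctTuples hr _ fun _ => ha) h

theorem HasHyperDeriv.norm_le {M : ℝ} (hr : 0 < r) (ha : a ∈ closedBall b r)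
    (h : HasHyperDeriv j (closedBall b r) g a d)
    (hM : ∀ x ∈ distinctTuples (closedBall b r) (j + 1), ‖divDiff g j x‖ ≤ M) : ‖d‖ ≤ M := by
  have := nhdsWithin_distinctTuples_neBot hr (j + 1) (x := fun _ => a) fun _ => ha
  refine le_of_tendsto (Tendsto.norm h) ?_
  filter_upwards [self_mem_nhdsWithin] with x hx using hM x hx

theorem IsCn.hasHyperDeriv [ProperSpace K] [IsUltrametricDist C] [CompleteSpace C] (hr : 0 < r)
    (hg : IsCn n (closedBall b r) g) (hj : j ≤ n) (ha : a ∈ closedBall b r) :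
    HasHyperDeriv j (closedBall b r) g a (hyperDeriv j (closedBall b r) g a) := by
  obtain ⟨G, hG, hGx⟩ := hg.of_le hr hj
  have h : HasHyperDeriv j (closedBall b r) g a (G fun _ => a) := by
    refine (((hG (fun _ => a) fun _ _ => ha).mono fun x hx i _ => hx.1 i).tendsto).congr' ?_
    filter_upwards [self_mem_nhdsWithin] with x hx using hGx x hx
  rwa [h.hyperDeriv_eq hr ha]

/-- On small balls, the difference quotient of order `n` of a function of class `C^n` is uniformly
close to the hyperderivative. -/
theorem IsCn.exists_norm_divDiff_sub_hyperDeriv_le [ProperSpace K] [IsUltrametricDist C]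
    [CompleteSpace C] (hr : 0 < r) (hg : IsCn n (closedBall b r) g) {ε : ℝ} (hε : 0 < ε) :
    ∃ δ > 0, ∀ a ∈ closedBall b r, ∀ x ∈ distinctTuples (closedBall b r) (n + 1),
      (∀ k, ‖x k - a‖ ≤ δ) → ‖divDiff g n x - hyperDeriv n (closedBall b r) g a‖ ≤ ε := by
  obtain ⟨G, hG, hGx⟩ := hg
  have hu := (isCompact_univ_pi fun _ : Fin (n + 1) =>
    isCompact_closedBall b r).uniformContinuousOn_of_continuous hG
  obtain ⟨δ, hδ, h⟩ := Metric.uniformContinuousOn_iff.mp hu ε hε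
  refine ⟨δ / 2, half_pos hδ, fun a ha x hx hxa => ?_⟩
  have hd : HasHyperDeriv n (closedBall b r) g a (G fun _ => a) := by
    refine (((hG (fun _ => a) fun _ _ => ha).mono fun x hx i _ => hx.1 i).tendsto).congr' ?_
    filter_upwards [self_mem_nhdsWithin] with x hx using hGx x hx
  rw [hd.hyperDeriv_eq hr ha, ← hGx x hx, ← dist_eq_norm]
  refine (h x (fun i _ => hx.1 i) _ (fun _ _ => ha) ?_).le
  refine lt_of_le_of_lt ((dist_pi_le_iff (half_pos hδ).le).mpr fun i => ?_) (half_lt_self hδ)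
  rw [dist_eq_norm]
  exact hxa i

end

/-! ### Powers and Taylor polynomials. -/

section
variable {K C : Type*} [NontriviallyNormedField K] [NormedField C] [NormedAlgebra K C]

variable (C) in
/-- The function `t ↦ (t - a) ^ j`. -/
def subPow (a : K) (j : ℕ) : K → C := fun t => algebraMap K C ((t - a) ^ j)

theorem subPow_succ (a : K) (j : ℕ) : subPow C a (j + 1) = fun t => (t - a) • subPow C a j t := by
  funext t
  simp only [subPow, pow_succ', map_mul, Algebra.smul_def]

/-- Induction on the exponent by the product rule: at order at least `j`, the first term has order
above the remaining degree and vanishes. -/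
theorem divDiff_subPow_of_le (a : K) {i j : ℕ} (hij : j ≤ i) (x : Fin (i + 1) → K)
    (hx : Function.Injective x) : divDiff (subPow C a j) i x = if i = j then 1 else 0 := by
  induction j generalizing i with
  | zero =>
    cases i with
    | zero => simp [divDiff, subPow]
    | succ i =>
      have : ∀ i : ℕ, ∀ x : Fin (i + 2) → K, divDiff (subPow C a 0) (i + 1) x = 0 := by
        intro i
        induction i with
        | zero => intro x; simp [divDiff, subPow]
        | succ i ih => intro x; rw [divDiff, ih, ih]; simp
      simpa using this i x
  | succ j ih =>
    obtain ⟨i, rfl⟩ := Nat.exists_eq_add_of_le' (show 1 ≤ i by omega)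
    rw [subPow_succ, divDiff_sub_smul _ _ _ _ hx, ih (by omega) x hx,
      ih (by omega) (fun k => x k.succ) (hx.comp (Fin.succ_injective _)), if_neg (by omega)]
    simp

/-- The quotient is homogeneous of degree $j-i$. In the product rule, one term gains a factor
$x_0-a$ of size at most $r$, the other lowers degree and order together. -/
theorem norm_divDiff_subPow_le [IsUltrametricDist C] (a : K) {r : ℝ} (hr : 0 < r) (i j : ℕ)
    (x : Fin (i + 1) → K) (hx : x ∈ distinctTuples (closedBall a r) (i + 1)) :
    ‖divDiff (subPow C a j) i x‖ ≤ r ^ j / r ^ i := by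
  induction j generalizing i with
  | zero =>
    rw [divDiff_subPow_of_le a (Nat.zero_le i) x hx.2]
    split_ifs with h
    · subst h; simp
    · simpa using (pow_pos hr i).le
  | succ j ih =>
    have h0 : ‖x 0 - a‖ ≤ r := by simpa [dist_eq_norm] using hx.1 0
    cases i with
    | zero =>
      simp only [divDiff, subPow, norm_algebraMap', norm_pow, pow_zero, div_one]
      exact pow_le_pow_left₀ (norm_nonneg _) h0 _
    | succ i =>
      rw [subPow_succ, divDiff_sub_smul _ _ _ _ hx.2]
      refine (IsUltrametricDist.norm_add_le_max _ _).trans (max_le ?_ ?_)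
      · rw [norm_smul]
        refine (mul_le_mul h0 (ih _ x hx) (norm_nonneg _) hr.le).trans (le_of_eq ?_)
        rw [pow_succ' r j, mul_div_assoc]
      · refine (ih i _ ⟨fun k => hx.1 _, hx.2.comp (Fin.succ_injective _)⟩).trans (le_of_eq ?_)
        rw [pow_succ, pow_succ, mul_div_mul_right _ _ hr.ne']

/-- In the product rule the factor $x_0-a$ tends to $0$ and kills the first term, leaving order and
degree both lowered by one. -/
theorem hasHyperDeriv_subPow (B : Set K) (a : K) (i j : ℕ) :
    HasHyperDeriv i B (subPow C a j) a (if i = j then 1 else 0) := by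
  induction j generalizing i with
  | zero =>
    refine tendsto_const_nhds.congr' ?_
    filter_upwards [self_mem_nhdsWithin] with x hx
    exact (divDiff_subPow_of_le a (Nat.zero_le i) x hx.2).symm
  | succ j ih =>
    cases i with
    | zero =>
      have : Continuous fun x : Fin 1 → K => subPow C a (j + 1) (x 0) :=
        (continuous_algebraMap K C).comp (((continuous_apply 0).sub continuous_const).pow _)
      refine tendsto_nhdsWithin_of_tendsto_nhds ((this.tendsto _).mono_right ?_)
      simp [subPow]
    | succ i =>
      have h1 : Tendsto (fun x : Fin (i + 2) → K => x 0 - a)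
          (𝓝[distinctTuples B (i + 2)] fun _ => a) (𝓝 0) := by
        have : Continuous fun x : Fin (i + 2) → K => x 0 - a := by fun_prop
        simpa using tendsto_nhdsWithin_of_tendsto_nhds (this.tendsto fun _ => a)
      have h2 : Tendsto (fun x : Fin (i + 2) → K => fun k : Fin (i + 1) => x k.succ)
          (𝓝[distinctTuples B (i + 2)] fun _ => a) (𝓝[distinctTuples B (i + 1)] fun _ => a) := by
        have : Continuous fun x : Fin (i + 2) → K => fun k : Fin (i + 1) => x k.succ := by fun_prop
        refine tendsto_nhdsWithin_iff.mpr
          ⟨tendsto_nhdsWithin_of_tendsto_nhds (this.tendsto fun _ => a), ?_⟩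
        filter_upwards [self_mem_nhdsWithin] with x hx
        exact ⟨fun k => hx.1 _, hx.2.comp (Fin.succ_injective _)⟩
      have h3 := (h1.smul (ih (i + 1))).add ((ih i).comp h2)
      simp only [zero_smul, zero_add] at h3
      have h4 : (if i + 1 = j + 1 then (1 : C) else 0) = if i = j then 1 else 0 := by simp
      rw [h4]
      refine h3.congr' ?_
      filter_upwards [self_mem_nhdsWithin] with x hx
      rw [subPow_succ, divDiff_sub_smul _ _ _ _ hx.2]
      rfl

/-- The polynomial function `t ↦ ∑_{j ≤ h} d_j (t - a) ^ j`. -/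
def taylorSum (h : ℕ) (d : ℕ → C) (a : K) : K → C :=
  ∑ j ∈ Finset.range (h + 1), d j • subPow C a j

theorem HasHyperDeriv.const_smul {j : ℕ} {B : Set K} {g : K → C} {a : K} {d : C} (e : C)
    (hg : HasHyperDeriv j B g a d) : HasHyperDeriv j B (e • g) a (e • d) :=
  (Tendsto.const_smul hg e).congr fun x => (divDiff_smul e g j x).symm

theorem hasHyperDeriv_taylorSum (B : Set K) (d : ℕ → C) (a : K) {i h : ℕ} (hi : i ≤ h) :
    HasHyperDeriv i B (taylorSum h d a) a (d i) := by
  have := HasHyperDeriv.sum (s := Finset.range (h + 1)) fun j _ =>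
    (hasHyperDeriv_subPow (C := C) B a i j).const_smul (d j)
  simpa [Nat.lt_succ_of_le hi, taylorSum] using this

theorem divDiff_taylorSum_self (d : ℕ → C) (a : K) (h : ℕ) (x : Fin (h + 1) → K)
    (hx : Function.Injective x) : divDiff (taylorSum h d a) h x = d h := by
  rw [taylorSum, divDiff_sum, Finset.sum_eq_single h]
  · rw [divDiff_smul, divDiff_subPow_of_le a le_rfl x hx]; simp
  · intro j hj hjh
    rw [divDiff_smul, divDiff_subPow_of_le a (Nat.lt_succ_iff.mp (Finset.mem_range.mp hj)) x hx,
      if_neg hjh.symm, smul_zero]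
  · simp

/-- Binomial expansion around the new center. It makes "polynomial of degree at most `h` on a ball"
independent of the center, so that passing to smaller balls is harmless. -/
theorem exists_taylorSum_eq_taylorSum (h : ℕ) (d : ℕ → C) (a b : K) :
    ∃ d' : ℕ → C, taylorSum h d a = taylorSum h d' b := by
  -- These are the coefficients of $((t-b)+(b-a))^j$. For $i>j$ the truncated exponent `j - i` is
  -- harmless because the binomial coefficient is $0$.
  refine ⟨fun i => ∑ j ∈ Finset.range (h + 1),
    d j * algebraMap K C ((b - a) ^ (j - i) * (j.choose i : K)), ?_⟩
  funext t
  simp only [taylorSum, Finset.sum_apply, Pi.smul_apply, smul_eq_mul, Finset.sum_mul]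
  rw [Finset.sum_comm]
  refine Finset.sum_congr rfl fun j hj => ?_
  simp only [mul_assoc, ← Finset.mul_sum]
  congr 1
  simp only [subPow, ← map_mul, ← map_sum]
  congr 1
  rw [← sub_add_sub_cancel t b a, add_pow]
  refine (Finset.sum_congr rfl fun i _ => ?_).trans (Finset.sum_subset
    (Finset.range_subset_range.mpr (Finset.mem_range.mp hj)) fun i _ hi => ?_)
  · ring
  · rw [Nat.choose_eq_zero_of_lt (by simpa using hi)]; simp

/-- The error of the Taylor polynomial, estimated through the difference quotients. -/
theorem norm_divDiff_sub_taylorSum_le [IsUltrametricDist K] [IsUltrametricDist C] {f : K → C}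
    {a : K} {r ε : ℝ} (hr : 0 < r) {h : ℕ} {d : ℕ → C}
    (hd : ∀ j ≤ h, HasHyperDeriv j (closedBall a r) f a (d j))
    (hε : ∀ x ∈ distinctTuples (closedBall a r) (h + 1), ‖divDiff f h x - d h‖ ≤ ε) {i : ℕ}
    (hi : i ≤ h) : ∀ x ∈ distinctTuples (closedBall a r) (i + 1),
      ‖divDiff (f - taylorSum h d a) i x‖ ≤ ε * r ^ h / r ^ i := by
  induction hi using Nat.decreasingInduction with
  | self =>
    intro x hx
    rw [divDiff_sub, divDiff_taylorSum_self _ _ _ _ hx.2, mul_div_assoc,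
      div_self (pow_pos hr h).ne', mul_one]
    exact hε x hx
  | of_succ k hk ih =>
    intro x hx
    -- The quotient of order `k` of the error tends to $0$ at $(a,\dots,a)$, so its size at `x` is
    -- the limit of its differences between `x` and nearby `y`, which the bound of order `k + 1`
    -- controls at the cost of one factor $r$.
    have h0 : HasHyperDeriv k (closedBall a r) (f - taylorSum h d a) a 0 := by
      simpa using (hd k hk.le).sub (hasHyperDeriv_taylorSum (closedBall a r) d a hk.le)
    have := nhdsWithin_distinctTuples_neBot hr (k + 1) (x := fun _ => a)
      fun _ => mem_closedBall_self hr.le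
    have hl := (tendsto_const_nhds (x := divDiff (f - taylorSum h d a) k x)).sub h0 |>.norm
    rw [sub_zero] at hl
    refine le_of_tendsto hl ?_
    filter_upwards [self_mem_nhdsWithin] with y hy
    refine (norm_divDiff_sub_le _ k hr hr ih hx hy fun m =>
      norm_sub_le_of_mem_closedBall (hx.1 m) (hy.1 m)).trans (le_of_eq ?_)
    rw [pow_succ]
    field_simp

end

/-! ### Local parameters, cut-off monomials and their norms. -/

section
variable {K : Type*} [NormedField K]

theorem localCoord_localParam (c : OnePoint K) (t : K) : localCoord c (localParam c t) = t := by
  induction c using OnePoint.rec with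
  | infty => by_cases h : t = 0 <;> simp [localCoord, localParam, h]
  | coe a => rfl

theorem localParam_injective (c : OnePoint K) : Function.Injective (localParam c) :=
  Function.LeftInverse.injective (localCoord_localParam c)

theorem localParam_mem_projBall {c : OnePoint K} {r : ℝ} {t : K}
    (ht : t ∈ closedBall (centerCoord c) r) : localParam c t ∈ projBall c r := by
  induction c using OnePoint.rec with
  | infty =>
    rw [mem_closedBall, dist_eq_norm] at ht
    simp only [centerCoord, OnePoint.elim_infty, sub_zero] at ht
    by_cases h : t = 0
    · subst h
      simp [localParam, projBall]
    · intro s hs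
      simp only [localParam, OnePoint.elim_infty, h, if_false] at hs
      rw [← OnePoint.coe_injective hs, norm_inv, ← div_eq_mul_inv,
        one_le_div (norm_pos_iff.mpr h)]
      exact ht
  | coe a => exact ⟨t, rfl, by simpa [centerCoord, dist_eq_norm] using ht⟩

end

namespace BallDecomposition

section
variable {K : Type*} [NormedField K] {π : K} {l₀ : ℤ} {S : Set (OnePoint K)}
  (D : BallDecomposition π l₀ S) {c c' : OnePoint K} {t : K}

theorem projBall_subset (hc : c ∈ D.centers) : projBall c (‖π‖ ^ l₀) ⊆ S := by
  intro x hx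
  rw [← D.union_eq]
  exact Set.mem_biUnion (Finset.mem_coe.mpr hc) hx

theorem localParam_mem (hc : c ∈ D.centers) (ht : t ∈ D.piece c) : localParam c t ∈ S :=
  D.projBall_subset hc (localParam_mem_projBall ht)

theorem localRep_apply {C : Type*} [Zero C] (f : S → C) (hc : c ∈ D.centers)
    (ht : t ∈ D.piece c) : D.localRep f c t = f ⟨localParam c t, D.localParam_mem hc ht⟩ := by
  rw [localRep, dif_pos (D.localParam_mem hc ht)]

theorem exists_localParam_eq (x : S) : ∃ c ∈ D.centers, ∃ t ∈ D.piece c, localParam c t = x := by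
  have hx : (x : OnePoint K) ∈ ⋃ c ∈ D.centers, projBall c (‖π‖ ^ l₀) := D.union_eq.symm ▸ x.2
  simp only [Set.mem_iUnion, exists_prop] at hx
  obtain ⟨c, hc, hxc⟩ := hx
  obtain ⟨h1, h2⟩ := localCoord_spec (zpow_nonneg (norm_nonneg π) l₀) hxc
  exact ⟨c, hc, _, h1, h2⟩

theorem ext_localRep {C : Type*} [Zero C] {f g : S → C}
    (h : ∀ c ∈ D.centers, ∀ t ∈ D.piece c, D.localRep f c t = D.localRep g c t) : f = g := by
  funext x
  obtain ⟨c, hc, t, ht, hx⟩ := D.exists_localParam_eq x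
  have := h c hc t ht
  rw [D.localRep_apply f hc ht, D.localRep_apply g hc ht] at this
  obtain rfl : x = ⟨localParam c t, D.localParam_mem hc ht⟩ := Subtype.ext hx.symm
  exact this

theorem eq_of_localParam_eq {s : K} (hc : c ∈ D.centers) (hc' : c' ∈ D.centers)
    (ht : t ∈ D.piece c) (hs : s ∈ D.piece c') (h : localParam c t = localParam c' s) :
    c = c' := by
  by_contra hne
  exact Set.disjoint_left.mp (D.disjoint hc hc' hne) (localParam_mem_projBall ht)
    (h ▸ localParam_mem_projBall hs)

theorem localRep_sub {C : Type*} [Ring C] (f g : S → C) (c : OnePoint K) :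
    D.localRep (f - g) c = D.localRep f c - D.localRep g c := by
  funext t; by_cases h : localParam c t ∈ S <;> simp [localRep, h]

end

section
variable {K C : Type*} [NontriviallyNormedField K] [IsUltrametricDist K]
  [NormedField C] [NormedAlgebra K C] {π : K} {l₀ : ℤ} {S : Set (OnePoint K)}
  (D : BallDecomposition π l₀ S) {c c' : OnePoint K} {a t : K} {l : ℤ} {h j : ℕ}

omit [IsUltrametricDist K] in
theorem radius_anti (hπ : 0 < ‖π‖) (hπ1 : ‖π‖ < 1) {l l' : ℤ} (hl : l ≤ l') :
    ‖π‖ ^ l' ≤ ‖π‖ ^ l :=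
  zpow_le_zpow_right_of_le_one₀ hπ hπ1.le hl

theorem closedBall_subset_piece (hπ : 0 < ‖π‖) (hπ1 : ‖π‖ < 1) (ha : a ∈ D.piece c)
    (hl : l₀ ≤ l) : closedBall a (‖π‖ ^ l) ⊆ D.piece c :=
  closedBall_subset_of_mem ha (radius_anti hπ hπ1 hl)

open Classical in
omit [IsUltrametricDist K] in
theorem localRep_localMonomial_self (hc : c ∈ D.centers) (ht : t ∈ D.piece c) :
    D.localRep (D.localMonomial c a l j) c t =
      if t ∈ closedBall a (‖π‖ ^ l) then subPow C a j t else 0 := by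
  rw [D.localRep_apply _ hc ht, localMonomial]
  simp only [(localParam_injective c).mem_set_image, localCoord_localParam, subPow]

theorem localRep_localMonomial_of_ne (hπ : 0 < ‖π‖) (hπ1 : ‖π‖ < 1) (hc : c ∈ D.centers)
    (ha : a ∈ D.piece c) (hl : l₀ ≤ l) (hc' : c' ∈ D.centers) (hcc : c' ≠ c)
    (ht : t ∈ D.piece c') : D.localRep (D.localMonomial (C := C) c a l j) c' t = 0 := by
  rw [D.localRep_apply _ hc' ht, localMonomial, if_neg]
  rintro ⟨s, hs, hst⟩
  exact hcc (D.eq_of_localParam_eq hc' hc ht (D.closedBall_subset_piece hπ hπ1 ha hl hs) hst.symm)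

/-- It suffices to treat nodes at mutual distance at most the radius. Such nodes lie either all
inside the ball, where the function is a power, or all outside, where it is $0$. -/
theorem norm_divDiff_localMonomial_le [IsUltrametricDist C] (hπ : 0 < ‖π‖) (hπ1 : ‖π‖ < 1)
    (hc : c ∈ D.centers) (ha : a ∈ D.piece c) (hl : l₀ ≤ l) (hc' : c' ∈ D.centers) (i j : ℕ)
    (x : Fin (i + 1) → K) (hx : x ∈ distinctTuples (D.piece c') (i + 1)) :
    ‖divDiff (D.localRep (D.localMonomial (C := C) c a l j) c') i x‖ ≤
      (‖π‖ ^ l) ^ j / (‖π‖ ^ l) ^ i := by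
  have hr : 0 < ‖π‖ ^ l := zpow_pos hπ l
  have h0 : ∀ i : ℕ, 0 ≤ (‖π‖ ^ l) ^ j / (‖π‖ ^ l) ^ i := fun i => by positivity
  by_cases hcc : c' = c
  · subst hcc
    refine norm_divDiff_le_of_close _ hr i (fun i _ x hx hxr => ?_) i le_rfl x hx
    by_cases hx0 : x 0 ∈ closedBall a (‖π‖ ^ l)
    · have hxa : ∀ k, x k ∈ closedBall a (‖π‖ ^ l) := fun k =>
        mem_closedBall_of_norm_sub_le hx0 le_rfl (hxr k 0)
      rw [divDiff_congr (g := subPow C a j) (B := closedBall a (‖π‖ ^ l)) _ i x hxa]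
      · exact norm_divDiff_subPow_le a hr i j x ⟨hxa, hx.2⟩
      · intro t ht
        rw [D.localRep_localMonomial_self hc (D.closedBall_subset_piece hπ hπ1 ha hl ht), if_pos ht]
    · have hxa : ∀ k, x k ∈ D.piece c' \ closedBall a (‖π‖ ^ l) := fun k =>
        ⟨hx.1 k, fun hk => hx0 (mem_closedBall_of_norm_sub_le hk le_rfl (hxr 0 k))⟩
      rw [divDiff_congr (g := 0) _ i x hxa, divDiff_zero_fun, norm_zero]
      · exact h0 i
      · intro t ht
        rw [D.localRep_localMonomial_self hc ht.1, if_neg ht.2]; rfl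
  · rw [divDiff_congr (g := 0) (fun t ht => D.localRep_localMonomial_of_ne hπ hπ1 hc ha hl hc'
      hcc ht) i x hx.1, divDiff_zero_fun, norm_zero]
    exact h0 i

theorem localMonomial_mem_cnFunctions [IsUltrametricDist C] [CompleteSpace C] (hπ : 0 < ‖π‖)
    (hπ1 : ‖π‖ < 1) (hc : c ∈ D.centers) (ha : a ∈ D.piece c) (hl : l₀ ≤ l) (h j : ℕ) :
    D.localMonomial c a l j ∈ D.cnFunctions C h := fun _ hc' =>
  isCn_of_norm_divDiff_succ_le (zpow_pos hπ l₀)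
    (D.norm_divDiff_localMonomial_le hπ hπ1 hc ha hl hc' (h + 1) j)

theorem locPoly_le_cnFunctions [IsUltrametricDist C] [CompleteSpace C] (hπ : 0 < ‖π‖)
    (hπ1 : ‖π‖ < 1) (h : ℕ) : D.locPoly C h ≤ D.cnFunctions C h := by
  refine Submodule.span_le.mpr ?_
  rintro _ ⟨c, hc, a, ha, l, hl, j, _, rfl⟩
  exact D.localMonomial_mem_cnFunctions hπ hπ1 hc ha hl h j

omit [IsUltrametricDist K] in
theorem localMonomial_mem_locPoly (hc : c ∈ D.centers) (ha : a ∈ D.piece c) (hl : l₀ ≤ l)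
    (hj : j ≤ h) : D.localMonomial c a l j ∈ D.locPoly C h :=
  Submodule.subset_span ⟨c, hc, a, ha, l, hl, j, hj, rfl⟩

/-- Since $l\ge0$ the radius is at most $1$, so among the orders $i\le h$ the worst bound is that of
order $h$. The result is the growth $|\pi|^{l(j-h)}$ of the admissibility condition. -/
theorem norm_localMonomial_le [IsUltrametricDist C] (hπ : 0 < ‖π‖)
    (hπ1 : ‖π‖ < 1) (hc : c ∈ D.centers) (ha : a ∈ D.piece c) (hl : l₀ ≤ l) (hl0 : 0 ≤ l)
    (hm : D.localMonomial c a l j ∈ D.cnFunctions C h) :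
    ‖CnSpace.mk _ hm‖ ≤ (‖π‖ ^ l) ^ j / (‖π‖ ^ l) ^ h := by
  have hr : 0 < ‖π‖ ^ l := zpow_pos hπ l
  refine CnSpace.norm_le_of_forall (by positivity) fun c' i x => ?_
  refine (D.norm_divDiff_localMonomial_le hπ hπ1 hc ha hl c'.2 i j x.1 x.2).trans ?_
  refine div_le_div_of_nonneg_left (by positivity) (by positivity) ?_
  refine pow_le_pow_of_le_one hr.le ?_ (Nat.lt_succ_iff.mp i.2)
  simpa using radius_anti hπ hπ1 hl0

/-! ### Approximation by Taylor polynomials -/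

/-- The function equal, on the ball around each sample point, to the Taylor polynomial of degree
`h` of `f` at this point. -/
noncomputable def taylorApprox (h : ℕ) (l : ℤ) (T : OnePoint K → Finset K) (f : S → C) : S → C :=
  ∑ c ∈ D.centers, ∑ a ∈ T c, ∑ j ∈ Finset.range (h + 1),
    hyperDeriv j (D.piece c) (D.localRep f c) a • D.localMonomial c a l j

omit [IsUltrametricDist K] in
theorem taylorApprox_mem_locPoly {T : OnePoint K → Finset K} (hT : D.IsSample l T) (hl : l₀ ≤ l)
    (f : S → C) : D.taylorApprox h l T f ∈ D.locPoly C h :=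
  Submodule.sum_mem _ fun c hc => Submodule.sum_mem _ fun a ha => Submodule.sum_mem _ fun _ hj =>
    Submodule.smul_mem _ _ (D.localMonomial_mem_locPoly hc ((hT c hc).1 a ha) hl
      (Nat.lt_succ_iff.mp (Finset.mem_range.mp hj)))

omit [IsUltrametricDist K] in
-- By linearity. `attach` supplies the membership proofs that place every monomial in $P^{(h)}$,
-- since `integral` takes its default value $0$ elsewhere.
theorem integral_taylorApprox {T : OnePoint K → Finset K} (hT : D.IsSample l T) (hl : l₀ ≤ l)
    (f : S → C) (μ : Module.Dual C (D.locPoly C h)) :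
    D.integral μ (D.taylorApprox h l T f) = D.riemannSum l T f μ := by
  let I := ∑ c ∈ D.centers.attach, ∑ a ∈ (T c).attach, ∑ j ∈ (Finset.range (h + 1)).attach,
    hyperDeriv j (D.piece c) (D.localRep f c) (a : K) •
      (⟨D.localMonomial c a l j, D.localMonomial_mem_locPoly c.2 ((hT c c.2).1 a a.2) hl
      (Nat.lt_succ_iff.mp (Finset.mem_range.mp j.2))⟩ : D.locPoly C h)
  have hm : ∀ c (hc : c ∈ D.centers) a (ha : a ∈ T c) j (hj : j ∈ Finset.range (h + 1)),
      D.localMonomial c a l j ∈ D.locPoly C h := fun c hc a ha j hj =>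
    D.localMonomial_mem_locPoly hc ((hT c hc).1 a ha) hl
      (Nat.lt_succ_iff.mp (Finset.mem_range.mp hj))
  have hI : (⟨_, D.taylorApprox_mem_locPoly (h := h) hT hl f⟩ : D.locPoly C h) = I := by
    apply Subtype.ext
    simp only [I, taylorApprox, Submodule.coe_sum, Submodule.coe_smul]
    rw [← Finset.sum_attach]
    refine Finset.sum_congr rfl fun c _ => ?_
    rw [← Finset.sum_attach]
    refine Finset.sum_congr rfl fun a _ => ?_
    rw [← Finset.sum_attach]
  rw [integral, dif_pos (D.taylorApprox_mem_locPoly hT hl f), hI, riemannSum]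
  simp only [I, map_sum, map_smul, smul_eq_mul]
  rw [← Finset.sum_attach D.centers]
  refine Finset.sum_congr rfl fun c _ => ?_
  rw [← Finset.sum_attach (T c)]
  refine Finset.sum_congr rfl fun a _ => ?_
  rw [← Finset.sum_attach (Finset.range (h + 1))]
  refine Finset.sum_congr rfl fun j _ => ?_
  rw [integral, dif_pos (hm c c.2 a a.2 j j.2)]

theorem localRep_taylorApprox (hπ : 0 < ‖π‖) (hπ1 : ‖π‖ < 1) {T : OnePoint K → Finset K}
    (hT : D.IsSample l T) (hl : l₀ ≤ l) (f : S → C) (hc : c ∈ D.centers) (ha : a ∈ T c)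
    (ht : t ∈ closedBall a (‖π‖ ^ l)) :
    D.localRep (D.taylorApprox h l T f) c t =
      taylorSum h (fun j => hyperDeriv j (D.piece c) (D.localRep f c) a) a t := by
  have htp : t ∈ D.piece c := D.closedBall_subset_piece hπ hπ1 ((hT c hc).1 a ha) hl ht
  have hmon : ∀ c' a' j, D.localMonomial (C := C) c' a' l j
      ⟨localParam c t, D.localParam_mem hc htp⟩ = D.localRep (D.localMonomial c' a' l j) c t :=
    fun c' a' j => (D.localRep_apply _ hc htp).symm
  rw [D.localRep_apply _ hc htp]
  simp only [taylorApprox, taylorSum, Finset.sum_apply, Pi.smul_apply, hmon]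
  rw [Finset.sum_eq_single_of_mem c hc, Finset.sum_eq_single_of_mem a ha]
  · refine Finset.sum_congr rfl fun j _ => ?_
    rw [D.localRep_localMonomial_self hc htp, if_pos ht]
  · intro a' ha' hne
    refine Finset.sum_eq_zero fun j _ => ?_
    rw [D.localRep_localMonomial_self hc htp, if_neg, smul_zero]
    exact fun ht' => hne (((hT c hc).2 t htp).unique ⟨ha', ht'⟩ ⟨ha, ht⟩)
  · intro c' hc' hne
    refine Finset.sum_eq_zero fun a' ha' => Finset.sum_eq_zero fun j _ => ?_
    rw [D.localRep_localMonomial_of_ne hπ hπ1 hc' ((hT c' hc').1 a' ha') hl hc hne.symm htp,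
      smul_zero]

end

section
variable {K C : Type*} [NontriviallyNormedField K] [IsUltrametricDist K] [ProperSpace K]
  [NormedField C] [NormedAlgebra K C] [IsUltrametricDist C] [CompleteSpace C]
  {π : K} {l₀ : ℤ} {S : Set (OnePoint K)}
  (D : BallDecomposition π l₀ S) {c c' : OnePoint K} {a t : K} {l : ℤ} {h j : ℕ}

theorem hasHyperDeriv (hπ : 0 < ‖π‖) {f : S → C} (hf : f ∈ D.cnFunctions C h)
    (hc : c ∈ D.centers) (ha : a ∈ D.piece c) (hj : j ≤ h) :
    HasHyperDeriv j (D.piece c) (D.localRep f c) a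
      (hyperDeriv j (D.piece c) (D.localRep f c) a) :=
  (hf c hc).hasHyperDeriv (zpow_pos hπ l₀) hj ha

/-- The difference quotients of the error of the approximation by Taylor polynomials. -/
theorem norm_divDiff_sub_taylorApprox_le (hπ : 0 < ‖π‖) (hπ1 : ‖π‖ < 1)
    {T : OnePoint K → Finset K} (hT : D.IsSample l T) (hl : l₀ ≤ l) {f : S → C}
    (hf : f ∈ D.cnFunctions C h) {ε : ℝ}
    (hε : ∀ c ∈ D.centers, ∀ a ∈ T c, ∀ x ∈ distinctTuples (closedBall a (‖π‖ ^ l)) (h + 1),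
      ‖divDiff (D.localRep f c) h x - hyperDeriv h (D.piece c) (D.localRep f c) a‖ ≤ ε)
    (hc : c ∈ D.centers) {i : ℕ} (hi : i ≤ h) :
    ∀ x ∈ distinctTuples (D.piece c) (i + 1),
      ‖divDiff (D.localRep (f - D.taylorApprox h l T f) c) i x‖ ≤
        ε * (‖π‖ ^ l) ^ h / (‖π‖ ^ l) ^ i := by
  refine norm_divDiff_le_of_close _ (zpow_pos hπ l) h (fun i hi x hx hxr => ?_) i hi
  -- Close nodes all lie in the ball of one sample point, where the approximation is a single Taylor
  -- polynomial.
  obtain ⟨a, ⟨ha, hxa⟩, -⟩ := (hT c hc).2 (x 0) (hx.1 0)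
  have hxa : ∀ k, x k ∈ closedBall a (‖π‖ ^ l) := fun k =>
    mem_closedBall_of_norm_sub_le hxa le_rfl (hxr k 0)
  have hap := (hT c hc).1 a ha
  have hsub := D.closedBall_subset_piece hπ hπ1 hap hl
  rw [divDiff_congr (g := D.localRep f c - taylorSum h
    (fun j => hyperDeriv j (D.piece c) (D.localRep f c) a) a) _ i x hxa]
  · exact norm_divDiff_sub_taylorSum_le (zpow_pos hπ l)
      (fun j hj => (D.hasHyperDeriv hπ hf hc hap hj).mono hsub) (hε c hc a ha) hi x ⟨hxa, hx.2⟩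
  · intro t ht
    rw [localRep_sub, Pi.sub_apply, Pi.sub_apply,
      D.localRep_taylorApprox hπ hπ1 hT hl f hc ha ht]

theorem norm_hyperDeriv_le (hπ : 0 < ‖π‖) {f : S → C} (hf : f ∈ D.cnFunctions C h)
    (hc : c ∈ D.centers) (ha : a ∈ D.piece c) (hj : j ≤ h) {M : ℝ}
    (hM : ∀ x ∈ distinctTuples (D.piece c) (j + 1), ‖divDiff (D.localRep f c) j x‖ ≤ M) :
    ‖hyperDeriv j (D.piece c) (D.localRep f c) a‖ ≤ M :=
  (D.hasHyperDeriv hπ hf hc ha hj).norm_le (zpow_pos hπ l₀) ha hM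

theorem CnSpace.norm_hyperDeriv_le (hπ : 0 < ‖π‖) (f : D.CnSpace C h)
    (hc : c ∈ D.centers) (ha : a ∈ D.piece c) (hj : j ≤ h) :
    ‖hyperDeriv j (D.piece c) (D.localRep f.toFun c) a‖ ≤ ‖f‖ :=
  D.norm_hyperDeriv_le hπ f.2 hc ha hj fun x hx =>
    f.norm_divDiff_le ⟨c, hc⟩ ⟨j, Nat.lt_succ_of_le hj⟩ ⟨x, hx⟩

omit [ProperSpace K] in
theorem taylorApprox_mem_cnFunctions (hπ : 0 < ‖π‖) (hπ1 : ‖π‖ < 1)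
    {T : OnePoint K → Finset K} (hT : D.IsSample l T) (hl : l₀ ≤ l) (f : S → C) :
    D.taylorApprox h l T f ∈ D.cnFunctions C h :=
  D.locPoly_le_cnFunctions hπ hπ1 h (D.taylorApprox_mem_locPoly hT hl f)

/-- The approximations by Taylor polynomials converge in `C^h(S)`. -/
theorem exists_norm_sub_taylorApprox_le (hπ : 0 < ‖π‖) (hπ1 : ‖π‖ < 1) {f : S → C}
    (hf : f ∈ D.cnFunctions C h) {ε : ℝ} (hε : 0 < ε) :
    ∃ L : ℤ, ∀ l ≥ L, l₀ ≤ l ∧ ∀ T : OnePoint K → Finset K, D.IsSample l T →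
      ∀ hm : f - D.taylorApprox h l T f ∈ D.cnFunctions C h, ‖CnSpace.mk _ hm‖ ≤ ε := by
  have h1 : ∃ δ > 0, ∀ c ∈ D.centers, ∀ a ∈ D.piece c,
      ∀ x ∈ distinctTuples (D.piece c) (h + 1), (∀ k, ‖x k - a‖ ≤ δ) →
        ‖divDiff (D.localRep f c) h x - hyperDeriv h (D.piece c) (D.localRep f c) a‖ ≤ ε := by
    -- Stated for all small $\delta>0$, so that one $\delta$ serves the finitely many centers.
    have key : ∀ c ∈ D.centers, ∀ᶠ δ in 𝓝[>] (0 : ℝ), ∀ a ∈ D.piece c,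
        ∀ x ∈ distinctTuples (D.piece c) (h + 1), (∀ k, ‖x k - a‖ ≤ δ) →
        ‖divDiff (D.localRep f c) h x - hyperDeriv h (D.piece c) (D.localRep f c) a‖ ≤ ε := by
      intro c hc
      obtain ⟨δ, hδ, hd⟩ :=
        (hf c hc).exists_norm_divDiff_sub_hyperDeriv_le (zpow_pos hπ l₀) hε
      filter_upwards [Ioo_mem_nhdsGT hδ] with δ' hδ' a ha x hx hxa
      exact hd a ha x hx fun k => (hxa k).trans hδ'.2.le
    obtain ⟨δ, hδ, hδ'⟩ := (((Filter.eventually_all_finset D.centers).mpr key).and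
      self_mem_nhdsWithin).exists
    exact ⟨δ, hδ', hδ⟩
  obtain ⟨δ, hδ, hd⟩ := h1
  obtain ⟨N, hN⟩ := exists_pow_lt_of_lt_one hδ hπ1
  -- The radius must be at most $\delta$ for the estimate of order $h$, and at most $1$ so that
  -- $\varepsilon r^{h-i}\le\varepsilon$.
  refine ⟨max (max l₀ 0) N, fun l hl => ?_⟩
  have hll : l₀ ≤ l := (le_max_left _ _).trans ((le_max_left _ _).trans hl)
  have hl0 : 0 ≤ l := (le_max_right _ _).trans ((le_max_left _ _).trans hl)
  have hlN : ‖π‖ ^ l ≤ δ :=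
    (radius_anti hπ hπ1 ((le_max_right _ _).trans hl)).trans (by simpa using hN.le)
  have hr : 0 < ‖π‖ ^ l := zpow_pos hπ l
  refine ⟨hll, fun T hT hm => CnSpace.norm_le_of_forall hε.le fun c i x => ?_⟩
  refine (D.norm_divDiff_sub_taylorApprox_le hπ hπ1 hT hll hf (ε := ε)
    (fun c hc a ha x hx => ?_) c.2 (Nat.lt_succ_iff.mp i.2) x.1 x.2).trans ?_
  · have hap := (hT c hc).1 a ha
    refine hd c hc a hap x
      ⟨fun k => D.closedBall_subset_piece hπ hπ1 hap hll (hx.1 k), hx.2⟩ fun k => ?_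
    rw [← dist_eq_norm]
    exact (hx.1 k).trans hlN
  · rw [mul_div_assoc]
    refine mul_le_of_le_one_right hε.le ((div_le_one (by positivity)).mpr ?_)
    refine pow_le_pow_of_le_one hr.le ?_ (Nat.lt_succ_iff.mp i.2)
    simpa using radius_anti hπ hπ1 hl0

end

end BallDecomposition

/-! ### Locally polynomial functions by level, and boundedness of admissible measures. -/

section
variable {K C : Type*} [NontriviallyNormedField K] [NormedField C] [NormedAlgebra K C]

theorem taylorSum_zero (h : ℕ) (a : K) : taylorSum h (0 : ℕ → C) a = 0 := by
  simp [taylorSum]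

theorem taylorSum_single {h j : ℕ} (hj : j ≤ h) (a : K) :
    taylorSum h (Pi.single j (1 : C)) a = subPow C a j := by
  rw [taylorSum, Finset.sum_eq_single_of_mem j (Finset.mem_range.mpr (Nat.lt_succ_of_le hj))]
  · simp
  · intro i _ hij
    simp [hij]

end

/-- Compactness gives a finite cover by balls of radius `r`; these are pairwise equal or disjoint,
so one center is kept for each distinct ball. -/
theorem exists_finset_closedBall_partition {K : Type*} [NormedField K] [IsUltrametricDist K]
    {U : Set K} (hU : IsCompact U) {r : ℝ} (hr : 0 < r) (h : ∀ x ∈ U, closedBall x r ⊆ U) :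
    ∃ F : Finset K, (∀ x ∈ F, x ∈ U) ∧ (F : Set K).PairwiseDisjoint (fun x => closedBall x r) ∧
      ⋃ x ∈ F, closedBall x r = U := by
  classical
  obtain ⟨F₀, hF₀, hcov⟩ := hU.elim_nhds_subcover (fun x => closedBall x r)
    fun x _ => closedBall_mem_nhds x hr
  obtain ⟨F, hF, hinj, himg⟩ : ∃ F ⊆ F₀, Set.InjOn (fun x : K => closedBall x r) F ∧
      F.image (fun x : K => closedBall x r) = F₀.image fun x => closedBall x r := by
    obtain ⟨u, hu, hb⟩ := (F₀ : Set K).exists_subset_bijOn (fun x : K => closedBall x r)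
    have hfin : u.Finite := F₀.finite_toSet.subset hu
    refine ⟨hfin.toFinset, by simpa [← Finset.coe_subset] using hu, by simpa using hb.injOn, ?_⟩
    apply Finset.coe_injective
    simpa using hb.image_eq
  refine ⟨F, fun x hx => hF₀ x (hF hx), fun x hx y hy hxy => ?_, ?_⟩
  · rcases IsUltrametricDist.closedBall_eq_or_disjoint x y r with he | he
    · exact absurd (hinj hx hy he) hxy
    · exact he
  · refine Set.Subset.antisymm (Set.iUnion₂_subset fun x hx => h x (hF₀ x (hF hx))) ?_
    intro t ht
    obtain ⟨x, hx, htx⟩ := Set.mem_iUnion₂.mp (hcov ht)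
    obtain ⟨y, hy, hyx⟩ := Finset.mem_image.mp (himg ▸ Finset.mem_image_of_mem _ hx)
    exact Set.mem_iUnion₂.mpr ⟨y, hy, hyx ▸ htx⟩

namespace BallDecomposition

section
variable {K C : Type*} [NontriviallyNormedField K] [IsUltrametricDist K] [ProperSpace K]
  [NormedField C] [NormedAlgebra K C] [IsUltrametricDist C] [CompleteSpace C]
  {π : K} {l₀ : ℤ} {S : Set (OnePoint K)}
  (D : BallDecomposition π l₀ S) {c c' : OnePoint K} {a t : K} {l : ℤ} {h j : ℕ}

theorem exists_isSample (hπ : 0 < ‖π‖) (hπ1 : ‖π‖ < 1) (hl : l₀ ≤ l) :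
    ∃ T : OnePoint K → Finset K, D.IsSample l T := by
  choose T hT using fun c : OnePoint K => exists_finset_closedBall_partition
    (isCompact_closedBall (centerCoord c) (‖π‖ ^ l₀)) (zpow_pos hπ l)
    fun x hx => closedBall_subset_of_mem hx (radius_anti hπ hπ1 hl)
  refine ⟨T, fun c _ => ⟨(hT c).1, fun t ht => ?_⟩⟩
  obtain ⟨a, ha, hta⟩ := Set.mem_iUnion₂.mp ((hT c).2.2.ge ht)
  refine ⟨a, ⟨ha, hta⟩, fun b hb => ?_⟩
  by_contra hne
  exact Set.disjoint_left.mp ((hT c).2.1 hb.1 ha hne) hb.2 hta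

variable (C) in
/-- The functions on `S` which agree with a polynomial of degree at most `h` on every ball of radius
`|π| ^ l`. -/
noncomputable def locPolyOfLevel (h : ℕ) (l : ℤ) : Submodule C (S → C) where
  carrier := {f | ∀ c ∈ D.centers, ∀ a ∈ D.piece c, ∃ d : ℕ → C, ∀ t ∈ closedBall a (‖π‖ ^ l),
    D.localRep f c t = taylorSum h d a t}
  add_mem' hf hg c hc a ha := by
    obtain ⟨d, hd⟩ := hf c hc a ha
    obtain ⟨e, he⟩ := hg c hc a ha
    refine ⟨d + e, fun t ht => ?_⟩
    rw [localRep_add, Pi.add_apply, hd t ht, he t ht]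
    simp [taylorSum, add_mul, Finset.sum_add_distrib]
  zero_mem' c _ a _ := ⟨0, fun t _ => by rw [localRep_zero, taylorSum_zero]⟩
  smul_mem' b f hf c hc a ha := by
    obtain ⟨d, hd⟩ := hf c hc a ha
    refine ⟨b • d, fun t ht => ?_⟩
    rw [localRep_smul, Pi.smul_apply, hd t ht]
    simp [taylorSum, Finset.mul_sum, mul_assoc]

omit [ProperSpace K] [IsUltrametricDist C] [CompleteSpace C] in
theorem localMonomial_mem_locPolyOfLevel (hπ : 0 < ‖π‖) (hπ1 : ‖π‖ < 1) (hc : c ∈ D.centers)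
    (ha : a ∈ D.piece c) (hl : l₀ ≤ l) {l' : ℤ} (hl' : l ≤ l') (hj : j ≤ h) :
    D.localMonomial c a l j ∈ D.locPolyOfLevel C h l' := by
  intro c' hc' a' ha'
  have hsub := D.closedBall_subset_piece hπ hπ1 ha' (hl.trans hl')
  by_cases hcc : c' = c
  · subst hcc
    by_cases haa : a' ∈ closedBall a (‖π‖ ^ l)
    · obtain ⟨d, hd⟩ := exists_taylorSum_eq_taylorSum h (Pi.single j (1 : C)) a a'
      refine ⟨d, fun t ht => ?_⟩
      rw [D.localRep_localMonomial_self hc' (hsub ht),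
        if_pos (closedBall_subset_of_mem haa (radius_anti hπ hπ1 hl') ht), ← hd, taylorSum_single hj]
    · refine ⟨0, fun t ht => ?_⟩
      rw [D.localRep_localMonomial_self hc' (hsub ht), if_neg, taylorSum_zero, Pi.zero_apply]
      intro hta
      refine haa (mem_closedBall_of_norm_sub_le hta le_rfl ?_)
      rw [norm_sub_rev, ← dist_eq_norm]
      exact (mem_closedBall.mp ht).trans (radius_anti hπ hπ1 hl')
  · exact ⟨0, fun t ht => by
      rw [D.localRep_localMonomial_of_ne hπ hπ1 hc ha hl hc' hcc (hsub ht), taylorSum_zero,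
        Pi.zero_apply]⟩

omit [ProperSpace K] [IsUltrametricDist C] [CompleteSpace C] in
theorem eventually_mem_locPolyOfLevel (hπ : 0 < ‖π‖) (hπ1 : ‖π‖ < 1) {f : S → C}
    (hf : f ∈ D.locPoly C h) : ∀ᶠ l in atTop, f ∈ D.locPolyOfLevel C h l := by
  induction hf using Submodule.span_induction with
  | mem f hf =>
    obtain ⟨c, hc, a, ha, l, hl, j, hj, rfl⟩ := hf
    filter_upwards [eventually_ge_atTop l] with l' hl'
    exact D.localMonomial_mem_locPolyOfLevel hπ hπ1 hc ha hl hl' hj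
  | zero => exact Eventually.of_forall fun l => Submodule.zero_mem _
  | add f g _ _ hf hg =>
    filter_upwards [hf, hg] with l hf hg using Submodule.add_mem _ hf hg
  | smul b f _ hf =>
    filter_upwards [hf] with l hf using Submodule.smul_mem _ b hf

omit [ProperSpace K] [IsUltrametricDist C] [CompleteSpace C] in
theorem taylorApprox_mem_locPolyOfLevel (hπ : 0 < ‖π‖) (hπ1 : ‖π‖ < 1)
    {T : OnePoint K → Finset K} (hT : D.IsSample l T) (hl : l₀ ≤ l) {l' : ℤ} (hl' : l ≤ l')
    (f : S → C) : D.taylorApprox h l T f ∈ D.locPolyOfLevel C h l' :=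
  Submodule.sum_mem _ fun c hc => Submodule.sum_mem _ fun a ha => Submodule.sum_mem _ fun _ hj =>
    Submodule.smul_mem _ _ (D.localMonomial_mem_locPolyOfLevel hπ hπ1 hc ((hT c hc).1 a ha) hl hl'
      (Nat.lt_succ_iff.mp (Finset.mem_range.mp hj)))

omit [ProperSpace K] [IsUltrametricDist C] [CompleteSpace C] in
-- The hyperderivatives at a sample point are the coefficients of the polynomial there. This stops
-- the telescoping for elements of $P^{(h)}$ and makes finer approximations reproduce coarser ones.
theorem taylorApprox_eq_self (hπ : 0 < ‖π‖) (hπ1 : ‖π‖ < 1)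
    {T : OnePoint K → Finset K} (hT : D.IsSample l T) (hl : l₀ ≤ l) {f : S → C}
    (hf : f ∈ D.locPolyOfLevel C h l) : D.taylorApprox h l T f = f := by
  refine D.ext_localRep fun c hc t ht => ?_
  obtain ⟨a, ⟨ha, hta⟩, -⟩ := (hT c hc).2 t ht
  have hap := (hT c hc).1 a ha
  obtain ⟨d, hd⟩ := hf c hc a hap
  rw [D.localRep_taylorApprox hπ hπ1 hT hl f hc ha hta, hd t hta]
  simp only [taylorSum, Finset.sum_apply, Pi.smul_apply]
  refine Finset.sum_congr rfl fun j hj => ?_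
  have hD : HasHyperDeriv j (D.piece c) (D.localRep f c) a (d j) :=
    (hasHyperDeriv_taylorSum (closedBall a (‖π‖ ^ l)) d a
      (Nat.lt_succ_iff.mp (Finset.mem_range.mp hj))).congr_of_closedBall (zpow_pos hπ l)
      fun t ht => (hd t ht).symm
  rw [show hyperDeriv j (D.piece c) (D.localRep f c) a = d j from
    hD.hyperDeriv_eq (zpow_pos hπ l₀) hap]

theorem riemannSum_sub (hπ : 0 < ‖π‖) {T : OnePoint K → Finset K} (hT : D.IsSample l T)
    {f g : S → C} (hf : f ∈ D.cnFunctions C h) (hg : g ∈ D.cnFunctions C h)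
    (μ : Module.Dual C (D.locPoly C h)) :
    D.riemannSum l T (f - g) μ = D.riemannSum l T f μ - D.riemannSum l T g μ := by
  simp only [riemannSum, ← Finset.sum_sub_distrib]
  refine Finset.sum_congr rfl fun c hc => Finset.sum_congr rfl fun a ha =>
    Finset.sum_congr rfl fun j hj => ?_
  have hap := (hT c hc).1 a ha
  have hj' := Nat.lt_succ_iff.mp (Finset.mem_range.mp hj)
  rw [localRep_sub, show hyperDeriv j (D.piece c) (D.localRep f c - D.localRep g c) a = _ from
    ((D.hasHyperDeriv hπ hf hc hap hj').sub (D.hasHyperDeriv hπ hg hc hap hj')).hyperDeriv_eq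
      (zpow_pos hπ l₀) hap, sub_mul]

omit [IsUltrametricDist K] [ProperSpace K] [CompleteSpace C] in
/-- A termwise bound for Riemann sums. -/
theorem norm_riemannSum_le {T : OnePoint K → Finset K} (hT : D.IsSample l T) {f : S → C}
    {μ : Module.Dual C (D.locPoly C h)} {X Y M : ℝ} (hπ : 0 < ‖π‖)
    (hX : 0 ≤ X) (hM : 0 ≤ M)
    (hf : ∀ c ∈ D.centers, ∀ a ∈ D.piece c, ∀ j ≤ h,
      ‖hyperDeriv j (D.piece c) (D.localRep f c) a‖ ≤ X / Y ^ j)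
    (hμ : ∀ c ∈ D.centers, ∀ a ∈ D.piece c, ∀ j ≤ h,
      ‖D.integral μ (D.localMonomial c a l j)‖ ≤ M * ((‖π‖ ^ l) ^ j / (‖π‖ ^ l) ^ h))
    (hY : 0 < Y) (hY' : ‖π‖ ^ l ≤ Y) :
    ‖D.riemannSum l T f μ‖ ≤ X * (M / (‖π‖ ^ l) ^ h) := by
  have hr : 0 < ‖π‖ ^ l := zpow_pos hπ l
  have h0 : 0 ≤ X * (M / (‖π‖ ^ l) ^ h) := by positivity
  refine IsUltrametricDist.norm_sum_le_of_forall_le_of_nonneg h0 fun c hc =>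
    IsUltrametricDist.norm_sum_le_of_forall_le_of_nonneg h0 fun a ha =>
    IsUltrametricDist.norm_sum_le_of_forall_le_of_nonneg h0 fun j hj => ?_
  have hj' := Nat.lt_succ_iff.mp (Finset.mem_range.mp hj)
  have hap := (hT c hc).1 a ha
  rw [norm_mul]
  -- Since $|\pi|^l\le Y$, the bounds for the terms are largest at $j=0$.
  calc _ ≤ X / Y ^ j * (M * ((‖π‖ ^ l) ^ j / (‖π‖ ^ l) ^ h)) :=
        mul_le_mul (hf c hc a hap j hj') (hμ c hc a hap j hj') (norm_nonneg _) (by positivity)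
    _ = (X * (M / (‖π‖ ^ l) ^ h)) * ((‖π‖ ^ l) ^ j / Y ^ j) := by ring
    _ ≤ X * (M / (‖π‖ ^ l) ^ h) := by
        refine mul_le_of_le_one_right h0 ((div_le_one (by positivity)).mpr ?_)
        exact pow_le_pow_left₀ hr.le hY' _

omit [IsUltrametricDist K] [ProperSpace K] [CompleteSpace C] [IsUltrametricDist C] in
theorem integral_coe (μ : Module.Dual C (D.locPoly C h)) (p : D.locPoly C h) :
    D.integral μ p = μ p := by
  rw [integral, dif_pos p.2]

/-- An admissible measure is bounded with respect to the norm of `C^h(S)`. -/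
theorem exists_norm_le_of_mem_admissibleMeasures (hπ : 0 < ‖π‖) (hπ1 : ‖π‖ < 1)
    {μ : Module.Dual C (D.locPoly C h)} (hμ : μ ∈ D.admissibleMeasures C h) :
    ∃ M : ℝ, ∀ (p : S → C) (hp : p ∈ D.locPoly C h),
      ‖μ ⟨p, hp⟩‖ ≤ M * ‖CnSpace.mk p (D.locPoly_le_cnFunctions hπ hπ1 h hp)‖ := by
  obtain ⟨A, L, hA⟩ := hμ
  -- The starting level: admissibility holds from here on, and $0\le L'$ keeps the radius at most
  -- $1$, as the initial sum requires.
  obtain ⟨L', hL0, hL1, hL2⟩ : ∃ L' : ℤ, l₀ ≤ L' ∧ L ≤ L' ∧ 0 ≤ L' :=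
    ⟨max l₀ (max L 0), le_max_left _ _, (le_max_left _ _).trans (le_max_right _ _),
      (le_max_right _ _).trans (le_max_right _ _)⟩
  have hμ' : ∀ l ≥ L', ∀ c ∈ D.centers, ∀ a ∈ D.piece c, ∀ j ≤ h,
      ‖D.integral μ (D.localMonomial c a l j)‖ ≤ |A| * ((‖π‖ ^ l) ^ j / (‖π‖ ^ l) ^ h) := by
    intro l hl c hc a ha j hj
    refine (hA l (hL0.trans hl) (hL1.trans hl) c hc a ha j hj).trans ?_
    have e : ‖π‖ ^ (l * ((j : ℤ) - h)) = (‖π‖ ^ l) ^ j / (‖π‖ ^ l) ^ h := by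
      rw [zpow_mul, zpow_sub₀ (zpow_pos hπ l).ne', zpow_natCast, zpow_natCast]
    rw [e]
    have : 0 < ‖π‖ ^ l := zpow_pos hπ l
    exact mul_le_mul_of_nonneg_right (le_abs_self A) (by positivity)
  choose! T hT using fun l (hl : l₀ ≤ l) => D.exists_isSample hπ hπ1 hl
  have hr' : 0 < ‖π‖ ^ L' := zpow_pos hπ L'
  -- The first constant bounds the Riemann sum of level $L'$, the second each refinement step.
  refine ⟨max (|A| / (‖π‖ ^ L') ^ h) (|A| / ‖π‖ ^ h), fun p hp => ?_⟩
  set N := ‖CnSpace.mk p (D.locPoly_le_cnFunctions hπ hπ1 h hp)‖ with hN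
  have hN0 : 0 ≤ N := CnSpace.norm_nonneg' _
  have hpC := D.locPoly_le_cnFunctions hπ hπ1 h hp
  have hbound : ∀ c ∈ D.centers, ∀ a ∈ D.piece c, ∀ j ≤ h,
      ‖hyperDeriv j (D.piece c) (D.localRep p c) a‖ ≤ N := fun c hc a ha j hj =>
    CnSpace.norm_hyperDeriv_le D hπ (CnSpace.mk p hpC) hc ha hj
  have hind : ∀ l ≥ L', ‖D.riemannSum l (T l) p μ‖ ≤
      max (|A| / (‖π‖ ^ L') ^ h) (|A| / ‖π‖ ^ h) * N := by
    intro l hl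
    induction l, hl using Int.leInduction with
    | base =>
      refine (D.norm_riemannSum_le (hT _ hL0) hπ hN0 (abs_nonneg A) (Y := 1) ?_ (hμ' L' le_rfl)
        one_pos (by simpa using radius_anti hπ hπ1 hL2)).trans ?_
      · simpa using hbound
      · rw [mul_comm]
        exact mul_le_mul_of_nonneg_right (le_max_left _ _) hN0
    | succ l hl ih =>
      have hll := hL0.trans hl
      have hll' : l₀ ≤ l + 1 := by omega
      have hr : 0 < ‖π‖ ^ l := zpow_pos hπ l
      have hq := D.taylorApprox_mem_locPoly (h := h) (hT l hll) hll p
      have hqC := D.locPoly_le_cnFunctions hπ hπ1 h hq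
      -- Refinement does not change the integral of the coarser approximation, so the difference of
      -- consecutive Riemann sums is a Riemann sum of the Taylor error.
      have e1 : D.riemannSum (l + 1) (T (l + 1)) (D.taylorApprox h l (T l) p) μ =
          D.riemannSum l (T l) p μ := by
        rw [← D.integral_taylorApprox (hT _ hll') hll', D.taylorApprox_eq_self hπ hπ1 (hT _ hll')
          hll' (D.taylorApprox_mem_locPolyOfLevel hπ hπ1 (hT l hll) hll (by omega) p),
          D.integral_taylorApprox (hT l hll) hll]
      have e2 : D.riemannSum (l + 1) (T (l + 1)) p μ =
          D.riemannSum (l + 1) (T (l + 1)) (p - D.taylorApprox h l (T l) p) μ +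
            D.riemannSum l (T l) p μ := by
        rw [D.riemannSum_sub hπ (hT _ hll') hpC hqC, e1, sub_add_cancel]
      rw [e2]
      -- A maximum instead of a sum: the bound is independent of the number of refinements.
      refine (IsUltrametricDist.norm_add_le_max _ _).trans (max_le ?_ ih)
      have hs : p - D.taylorApprox h l (T l) p ∈ D.cnFunctions C h := Submodule.sub_mem _ hpC hqC
      -- The hyperderivatives of the error are at most $Nr^h/r^j$ with $r=|\pi|^l$. The factor $r^h$
      -- cancels the growth of the measure at level $l+1$ up to $|\pi|^{-h}$.
      refine (D.norm_riemannSum_le (hT _ hll') hπ (X := N * (‖π‖ ^ l) ^ h) (by positivity)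
        (abs_nonneg A) (Y := ‖π‖ ^ l) (fun c hc a ha j hj => ?_) (hμ' (l + 1) (by omega)) hr
        (radius_anti hπ hπ1 (by omega))).trans ?_
      · refine D.norm_hyperDeriv_le hπ hs hc ha hj
          (D.norm_divDiff_sub_taylorApprox_le hπ hπ1 (hT l hll) hll hpC ?_ hc hj)
        intro c hc a ha x hx
        have hap := (hT l hll c hc).1 a ha
        refine (IsUltrametricDist.norm_sub_le_max _ _).trans (max_le ?_ (hbound c hc a hap h le_rfl))
        exact (CnSpace.mk p hpC).norm_divDiff_le ⟨c, hc⟩ (Fin.last h)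
          ⟨x, fun k => D.closedBall_subset_piece hπ hπ1 hap hll (hx.1 k), hx.2⟩
      · rw [zpow_add_one₀ hπ.ne', mul_pow, mul_comm _ N]
        have : N * (‖π‖ ^ l) ^ h * (|A| / ((‖π‖ ^ l) ^ h * ‖π‖ ^ h)) = N * (|A| / ‖π‖ ^ h) := by
          field_simp
        rw [this]
        exact mul_le_mul_of_nonneg_left (le_max_right _ _) hN0
  -- At a level where `p` is polynomial on each ball, its Riemann sum is exactly $\mu(p)$.
  obtain ⟨l, hl, hlL⟩ := ((D.eventually_mem_locPolyOfLevel hπ hπ1 hp).and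
    (eventually_ge_atTop L')).exists
  have hll := hL0.trans hlL
  have := hind l hlL
  rwa [← D.integral_taylorApprox (hT l hll) hll, D.taylorApprox_eq_self hπ hπ1 (hT l hll) hll hl,
    D.integral_coe μ ⟨p, hp⟩] at this

end

end BallDecomposition

/-! ### Completeness of $C^h(S)$, density of $P^{(h)}$ and duality. -/

theorem tendsto_divDiff {K C ι : Type*} [NormedField K] [NormedAddCommGroup C] [NormedSpace K C]
    {F : ι → K → C} {f : K → C} {l : Filter ι} (n : ℕ) (x : Fin (n + 1) → K)
    (hF : ∀ i, Tendsto (fun k => F k (x i)) l (𝓝 (f (x i)))) :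
    Tendsto (fun k => divDiff (F k) n x) l (𝓝 (divDiff f n x)) := by
  induction n with
  | zero => exact hF 0
  | succ n ih => exact ((ih _ fun i => hF _).sub (ih _ fun i => hF _)).const_smul _

/-- `C` is only assumed normed; its copy of `K` supplies elements of norm greater than $1$, so that
continuity yields an operator norm. -/
theorem exists_norm_le_of_continuousLinearMap (K : Type*) {C E : Type*} [NontriviallyNormedField K]
    [NormedField C] [NormedAlgebra K C] [NormedAddCommGroup E] [NormedSpace C E] (μ : E →L[C] C) :
    ∃ M : ℝ, ∀ x, ‖μ x‖ ≤ M * ‖x‖ := by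
  let _ : NontriviallyNormedField C :=
    { (inferInstance : NormedField C) with
      non_trivial := by
        obtain ⟨x, hx⟩ := NormedField.exists_one_lt_norm K
        exact ⟨algebraMap K C x, by rwa [norm_algebraMap']⟩ }
  exact ⟨‖μ‖, μ.le_opNorm⟩

theorem exists_continuousLinearMap_extension {C E P : Type*} [NormedField C] [CompleteSpace C]
    [NormedAddCommGroup E] [NormedSpace C E] [AddCommGroup P] [Module C P] {e : P →ₗ[C] E}
    (he : DenseRange e) (ν : P →ₗ[C] C) {M : ℝ} (hM : ∀ p, ‖ν p‖ ≤ M * ‖e p‖) :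
    ∃ μ : E →L[C] C, ∀ p, μ (e p) = ν p :=
  ⟨ν.extendOfNorm e, LinearMap.extendOfNorm_eq he ⟨M, hM⟩⟩

namespace BallDecomposition

section
variable {K C : Type*} [NontriviallyNormedField K] [IsUltrametricDist K] [ProperSpace K]
  [NormedField C] [NormedAlgebra K C] [CompleteSpace C]
  {π : K} {l₀ : ℤ} {S : Set (OnePoint K)}
  (D : BallDecomposition π l₀ S) {h : ℕ}

omit [IsUltrametricDist K] [CompleteSpace C] in
theorem CnSpace.norm_apply_le (f : D.CnSpace C h) (x : S) : ‖f.toFun x‖ ≤ ‖f‖ := by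
  obtain ⟨c, hc, t, ht, hx⟩ := D.exists_localParam_eq x
  have := f.norm_divDiff_le ⟨c, hc⟩ 0
    ⟨fun _ => t, fun _ => ht, fun i j _ => Subsingleton.elim (α := Fin 1) i j⟩
  obtain rfl : x = ⟨localParam c t, D.localParam_mem hc ht⟩ := Subtype.ext hx.symm
  rw [← D.localRep_apply f.toFun hc ht]
  exact this

theorem completeSpace_cnSpace (hπ : 0 < ‖π‖) : CompleteSpace (D.CnSpace C h) := by
  refine Metric.complete_of_cauchySeq_tendsto fun u hu => ?_
  have hpt : ∀ x : S, ∃ y, Tendsto (fun k => (u k).toFun x) atTop (𝓝 y) := by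
    refine fun x => cauchySeq_tendsto_of_complete (Metric.cauchySeq_iff.mpr fun ε hε => ?_)
    obtain ⟨N, hN⟩ := Metric.cauchySeq_iff.mp hu ε hε
    refine ⟨N, fun m hm n hn => lt_of_le_of_lt ?_ (hN m hm n hn)⟩
    rw [dist_eq_norm, dist_eq_norm]
    exact CnSpace.norm_apply_le D (u m - u n) x
  choose f hf using hpt
  have hrep : ∀ c t, Tendsto (fun k => D.localRep (u k).toFun c t) atTop
      (𝓝 (D.localRep f c t)) := by
    intro c t
    by_cases ht : localParam c t ∈ S
    · simp only [localRep, dif_pos ht]; exact hf _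
    · simp only [localRep, dif_neg ht]; exact tendsto_const_nhds
  have hdiff : ∀ ε > 0, ∃ N, ∀ k ≥ N, ∀ (c : D.centers) (j : Fin (h + 1))
      (x : distinctTuples (D.piece c.1) (j + 1)),
      ‖divDiff (D.localRep (u k).toFun c.1) j x.1 - divDiff (D.localRep f c.1) j x.1‖ ≤ ε := by
    intro ε hε
    obtain ⟨N, hN⟩ := Metric.cauchySeq_iff.mp hu ε hε
    refine ⟨N, fun k hk c j x => ?_⟩
    -- At fixed nodes a difference quotient depends on finitely many values, so the Cauchy estimate
    -- survives $m\to\infty$, uniformly in the nodes.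
    refine le_of_tendsto (tendsto_const_nhds.sub
      (tendsto_divDiff j x.1 fun i => hrep c.1 (x.1 i))).norm ?_
    filter_upwards [eventually_ge_atTop N] with m hm
    rw [← divDiff_sub, ← localRep_sub]
    refine (CnSpace.norm_divDiff_le (u k - u m) c j x).trans ?_
    rw [← dist_eq_norm]
    exact (hN k hk m hm).le
  have hfC : f ∈ D.cnFunctions C h := by
    intro c hc
    refine (isCn_iff_forall_norm_sub_le _ h (zpow_pos hπ l₀)).mpr fun x hx ε hε => ?_
    obtain ⟨N, hN⟩ := hdiff (ε / 3) (by positivity)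
    obtain ⟨δ, hδ, hd⟩ := (isCn_iff_forall_norm_sub_le _ h (zpow_pos hπ l₀)).mp
      ((u N).isCn hc) x hx (ε / 3) (by positivity)
    refine ⟨δ, hδ, fun y hy z hz hyx hzx => ?_⟩
    have h1 := hN N le_rfl ⟨c, hc⟩ (Fin.last h) ⟨y, hy⟩
    have h2 := hN N le_rfl ⟨c, hc⟩ (Fin.last h) ⟨z, hz⟩
    have h3 := hd y hy z hz hyx hzx
    simp only [← dist_eq_norm, Fin.val_last] at h1 h2 h3 ⊢
    rw [dist_comm] at h1
    linarith [dist_triangle4 (divDiff (D.localRep f c) h y)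
      (divDiff (D.localRep (u N).toFun c) h y) (divDiff (D.localRep (u N).toFun c) h z)
      (divDiff (D.localRep f c) h z)]
  refine ⟨CnSpace.mk f hfC, Metric.tendsto_atTop.mpr fun ε hε => ?_⟩
  obtain ⟨N, hN⟩ := hdiff (ε / 2) (half_pos hε)
  refine ⟨N, fun k hk => lt_of_le_of_lt ?_ (half_lt_self hε)⟩
  rw [dist_eq_norm]
  refine CnSpace.norm_le_of_forall (half_pos hε).le fun c j x => ?_
  have e : D.localRep (u k - CnSpace.mk f hfC).toFun c.1 =
      D.localRep (u k).toFun c.1 - D.localRep f c.1 := D.localRep_sub (u k).toFun f c.1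
  rw [e, divDiff_sub]
  exact hN k hk c j x

variable [IsUltrametricDist C]

variable (C h) in
/-- The inclusion of `P^{(h)}` in `C^h(S)`. -/
noncomputable def locPolyInclusion (hπ : 0 < ‖π‖) (hπ1 : ‖π‖ < 1) :
    D.locPoly C h →ₗ[C] D.CnSpace C h :=
  Submodule.inclusion (D.locPoly_le_cnFunctions hπ hπ1 h)

theorem tendsto_taylorApprox (hπ : 0 < ‖π‖) (hπ1 : ‖π‖ < 1) (f : D.CnSpace C h)
    {T : ℤ → OnePoint K → Finset K} (hT : ∀ l ≥ l₀, D.IsSample l (T l))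
    {p : ℤ → D.locPoly C h}
    (hp : ∀ l ≥ l₀, (p l : S → C) = D.taylorApprox h l (T l) f.toFun) :
    Tendsto (fun l => D.locPolyInclusion C h hπ hπ1 (p l)) atTop (𝓝 f) := by
  refine Metric.tendsto_atTop.mpr fun ε hε => ?_
  obtain ⟨L, hL⟩ := D.exists_norm_sub_taylorApprox_le hπ hπ1 f.2 (half_pos hε)
  refine ⟨L, fun l hl => lt_of_le_of_lt ?_ (half_lt_self hε)⟩
  obtain ⟨hll, hT'⟩ := hL l hl
  have hm : f.toFun - D.taylorApprox h l (T l) f.toFun ∈ D.cnFunctions C h :=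
    Submodule.sub_mem _ f.2 (D.taylorApprox_mem_cnFunctions hπ hπ1 (hT l hll) hll _)
  rw [dist_comm, dist_eq_norm]
  have e : f - D.locPolyInclusion C h hπ hπ1 (p l) = CnSpace.mk _ hm := by
    apply CnSpace.toFun_injective
    change f.toFun - (p l : S → C) = _
    rw [hp l hll]
    rfl
  rw [e]
  exact hT' (T l) (hT l hll) hm

theorem exists_taylorApprox_seq (hπ : 0 < ‖π‖) (hπ1 : ‖π‖ < 1) (f : D.CnSpace C h)
    {T : ℤ → OnePoint K → Finset K} (hT : ∀ l ≥ l₀, D.IsSample l (T l)) :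
    ∃ p : ℤ → D.locPoly C h,
      (∀ l ≥ l₀, (p l : S → C) = D.taylorApprox h l (T l) f.toFun) ∧
      Tendsto (fun l => D.locPolyInclusion C h hπ hπ1 (p l)) atTop (𝓝 f) := by
  classical
  let p : ℤ → D.locPoly C h := fun l => if hl : l₀ ≤ l then
    ⟨_, D.taylorApprox_mem_locPoly (hT l hl) hl f.toFun⟩ else 0
  have hp : ∀ l ≥ l₀, (p l : S → C) = D.taylorApprox h l (T l) f.toFun := fun l hl => by
    simp only [p, dif_pos (show l₀ ≤ l from hl)]
  exact ⟨p, hp, D.tendsto_taylorApprox hπ hπ1 f hT hp⟩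

theorem denseRange_locPolyInclusion (hπ : 0 < ‖π‖) (hπ1 : ‖π‖ < 1) :
    DenseRange (D.locPolyInclusion C h hπ hπ1) := by
  intro f
  choose! T hT using fun l (hl : l ≥ l₀) => D.exists_isSample hπ hπ1 hl
  obtain ⟨p, -, hp⟩ := D.exists_taylorApprox_seq hπ hπ1 f hT
  exact mem_closure_of_tendsto hp (Eventually.of_forall fun l => ⟨_, rfl⟩)

theorem comp_locPolyInclusion_mem_admissibleMeasures (hπ : 0 < ‖π‖) (hπ1 : ‖π‖ < 1)
    (μ : D.CnSpace C h →L[C] C) :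
    (μ : D.CnSpace C h →ₗ[C] C) ∘ₗ D.locPolyInclusion C h hπ hπ1 ∈ D.admissibleMeasures C h := by
  obtain ⟨M, hM⟩ := exists_norm_le_of_continuousLinearMap K μ
  refine ⟨|M|, 0, fun l hl hl0 c hc a ha j hj => ?_⟩
  have hm := D.localMonomial_mem_locPoly (C := C) (h := h) hc ha hl hj
  rw [integral, dif_pos hm, zpow_mul, zpow_sub₀ (zpow_pos hπ l).ne', zpow_natCast, zpow_natCast]
  refine (hM _).trans ?_
  exact mul_le_mul (le_abs_self M) (D.norm_localMonomial_le hπ hπ1 hc ha hl hl0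
    (D.localMonomial_mem_cnFunctions hπ hπ1 hc ha hl h j)) (norm_nonneg _) (abs_nonneg M)

variable (C h) in
/-- Restriction to `P^{(h)}`, from the continuous linear functionals on `C^h(S)` to the
`h`-admissible measures. -/
noncomputable def restrictDual (hπ : 0 < ‖π‖) (hπ1 : ‖π‖ < 1) :
    (D.CnSpace C h →L[C] C) →ₗ[C] D.admissibleMeasures C h where
  toFun μ := ⟨_, D.comp_locPolyInclusion_mem_admissibleMeasures hπ hπ1 μ⟩
  map_add' _ _ := rfl
  map_smul' _ _ := rfl

/-- Injectivity is density of $P^{(h)}$; surjectivity is extension by continuity of a functional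
bounded for $\|\cdot\|_h$. -/
theorem bijective_restrictDual (hπ : 0 < ‖π‖) (hπ1 : ‖π‖ < 1) :
    Function.Bijective (D.restrictDual C h hπ hπ1) := by
  refine ⟨fun μ ν hμν => ?_, fun μ => ?_⟩
  · apply ContinuousLinearMap.coeFn_injective
    refine (D.denseRange_locPolyInclusion hπ hπ1).equalizer μ.continuous ν.continuous ?_
    funext p
    exact LinearMap.congr_fun (congrArg Subtype.val hμν) p
  · obtain ⟨M, hM⟩ := D.exists_norm_le_of_mem_admissibleMeasures hπ hπ1 μ.2
    obtain ⟨ν, hν⟩ := exists_continuousLinearMap_extension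
      (D.denseRange_locPolyInclusion (C := C) (h := h) hπ hπ1) μ.1 fun p => hM p.1 p.2
    exact ⟨ν, Subtype.ext (LinearMap.ext hν)⟩

theorem tendsto_riemannSum (hπ : 0 < ‖π‖) (hπ1 : ‖π‖ < 1) (μ : D.CnSpace C h →L[C] C)
    (f : D.CnSpace C h) {T : ℤ → OnePoint K → Finset K} (hT : ∀ l ≥ l₀, D.IsSample l (T l)) :
    Tendsto (fun l => D.riemannSum l (T l) f.toFun (D.restrictDual C h hπ hπ1 μ).1) atTop
      (𝓝 (μ f)) := by
  obtain ⟨p, hp, hlim⟩ := D.exists_taylorApprox_seq hπ hπ1 f hT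
  refine ((μ.continuous.tendsto f).comp hlim).congr' ?_
  filter_upwards [eventually_ge_atTop l₀] with l hl
  rw [← D.integral_taylorApprox (hT l hl) hl, ← hp l hl, D.integral_coe]
  rfl

end

/-! ### Existence of decompositions -/

section
variable {K : Type*} [NontriviallyNormedField K] [IsUltrametricDist K] [ProperSpace K]
  {π : K} {S : Set (OnePoint K)}

omit [IsUltrametricDist K] [ProperSpace K] in
theorem exists_radius_closedBall_subset {U V : Set K} (hU : IsCompact U) (hV : IsOpen V)
    (hUV : U ⊆ V) (hπ1 : ‖π‖ < 1) (hπ : 0 < ‖π‖) :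
    ∃ L : ℤ, ∀ l ≥ L, ∀ x ∈ U, closedBall x (‖π‖ ^ l) ⊆ V := by
  obtain ⟨δ, hδ, h⟩ := hU.exists_cthickening_subset_open hV hUV
  obtain ⟨N, hN⟩ := exists_pow_lt_of_lt_one hδ hπ1
  refine ⟨N, fun l hl x hx => ?_⟩
  refine (closedBall_subset_closedBall ?_).trans
    ((closedBall_subset_cthickening hx δ).trans h)
  exact (radius_anti hπ hπ1 hl).trans (by simpa using hN.le)

omit [IsUltrametricDist K] [ProperSpace K] in
theorem projBall_coe (a : K) (r : ℝ) : projBall (a : OnePoint K) r = (↑) '' closedBall a r := by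
  ext x
  simp [projBall, dist_eq_norm, eq_comm, and_comm]

omit [ProperSpace K] in
/-- A decomposition of the part of `S` at finite distance, completed by the ball around `∞` if `S`
contains it. -/
theorem nonempty_of_finite_part {l : ℤ} (hπ : 0 < ‖π‖) {U : Set K} (hU : IsCompact U)
    (h : ∀ x ∈ U, closedBall x (‖π‖ ^ l) ⊆ U) {I : Set (OnePoint K)}
    (hI : I = ∅ ∨ I = projBall OnePoint.infty (‖π‖ ^ l)) (hd : Disjoint I ((↑) '' U))
    (hS : I ∪ (↑) '' U = S) : Nonempty (BallDecomposition π l S) := by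
  classical
  obtain ⟨F, hFU, hF, hFe⟩ := exists_finset_closedBall_partition hU (zpow_pos hπ l) h
  have hdis : ((F.image ((↑) : K → OnePoint K) : Finset (OnePoint K)) :
      Set (OnePoint K)).PairwiseDisjoint fun c => projBall c (‖π‖ ^ l) := by
    intro x hx y hy hxy
    simp only [Finset.coe_image, Set.mem_image, Finset.mem_coe] at hx hy
    obtain ⟨a, ha, rfl⟩ := hx
    obtain ⟨b, hb, rfl⟩ := hy
    simp only [Function.onFun, projBall_coe]
    exact (Set.disjoint_image_iff OnePoint.coe_injective).mpr
      (hF ha hb fun hab => hxy (congrArg _ hab))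
  have hun : ⋃ c ∈ F.image ((↑) : K → OnePoint K), projBall c (‖π‖ ^ l) = (↑) '' U := by
    simp only [Finset.set_biUnion_finset_image, projBall_coe, ← Set.image_iUnion, hFe]
  rcases hI with rfl | rfl
  · exact ⟨⟨F.image (↑), hdis, by rw [hun, ← hS, Set.empty_union]⟩⟩
  · refine ⟨⟨insert OnePoint.infty (F.image (↑)), ?_, ?_⟩⟩
    · rw [Finset.coe_insert]
      refine hdis.insert fun y hy _ => hd.mono_right ?_
      rw [← hun]
      exact Set.subset_biUnion_of_mem (u := fun c => projBall c (‖π‖ ^ l)) hy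
    · rw [Finset.set_biUnion_insert, hun, hS]

/-- If $\infty\in S$, the ball around $\infty$ is split off and the remaining part is compact and
stable under small translations; otherwise `S` itself is a compact open subset of `K`. -/
theorem exists_forall_nonempty (hπ : 0 < ‖π‖) (hπ1 : ‖π‖ < 1) (hSo : IsOpen S)
    (hSc : IsCompact S) : ∃ L : ℤ, ∀ l ≥ L, Nonempty (BallDecomposition π l S) := by
  set V : Set K := (↑) ⁻¹' S with hV
  have hVo : IsOpen V := hSo.preimage OnePoint.continuous_coe
  have hVc : IsClosed V := hSc.isClosed.preimage OnePoint.continuous_coe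
  by_cases hinf : OnePoint.infty ∈ S
  · obtain ⟨R, hR⟩ : ∃ R : ℝ, ∀ x : K, x ∉ V → ‖x‖ ≤ R :=
      ((OnePoint.isOpen_iff_of_mem hinf).mp hSo).2.isBounded.exists_norm_le
    obtain ⟨N, hN⟩ := exists_pow_lt_of_lt_one (show (0 : ℝ) < (|R| + 1)⁻¹ by positivity) hπ1
    have hNR : ∀ l : ℤ, l ≥ N → ∀ x : K, 1 ≤ ‖π‖ ^ l * ‖x‖ → x ∈ V := by
      intro l hl x hx
      by_contra hxV
      have h1 := hR x hxV
      have h2 : ‖π‖ ^ l ≤ ‖π‖ ^ N := by simpa using radius_anti hπ hπ1 hl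
      have h3 : ‖π‖ ^ l * ‖x‖ < 1 := by
        calc _ ≤ ‖π‖ ^ N * |R| := by
              refine mul_le_mul h2 (h1.trans (le_abs_self R)) (norm_nonneg _) (by positivity)
          _ ≤ (|R| + 1)⁻¹ * |R| := by gcongr
          _ < 1 := by
              rw [inv_mul_lt_iff₀ (by positivity)]; linarith
      linarith
    -- `V` may be unbounded, so a uniform radius is sought only on a bounded part; all points beyond
    -- it are in `V` by the choice of `N`.
    obtain ⟨L, hL⟩ := exists_radius_closedBall_subset
      (U := V ∩ closedBall 0 ((‖π‖ ^ N)⁻¹)) (V := V)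
      ((isCompact_closedBall _ _).inter_left hVc) hVo Set.inter_subset_left hπ1 hπ
    refine ⟨max (max L N) 1, fun l hl => ?_⟩
    have hl1 : l ≥ L := (le_max_left _ _).trans ((le_max_left _ _).trans hl)
    have hl2 : l ≥ N := (le_max_right _ _).trans ((le_max_left _ _).trans hl)
    have hl3 : 1 ≤ l := (le_max_right _ _).trans hl
    have hr : 0 < ‖π‖ ^ l := zpow_pos hπ l
    have hr1 : ‖π‖ ^ l < 1 := zpow_lt_one₀ hπ hπ1 (by omega)
    -- Points of the ball around $\infty$ have norm greater than $r$, so moving them by at most $r$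
    -- does not reduce their norm.
    have hbig : ∀ x s : K, 1 ≤ ‖π‖ ^ l * ‖x‖ → ‖s - x‖ ≤ ‖π‖ ^ l → 1 ≤ ‖π‖ ^ l * ‖s‖ := by
      intro x s hx hsx
      have h1 : ‖s - x‖ < ‖x‖ := by nlinarith [norm_nonneg x]
      have h2 : ‖x‖ ≤ ‖s‖ := by
        have := IsUltrametricDist.norm_sub_le_max s (s - x)
        rw [sub_sub_cancel] at this
        rcases le_max_iff.mp this with h | h
        · exact h
        · linarith
      exact hx.trans (mul_le_mul_of_nonneg_left h2 hr.le)
    have hopen : ∀ x ∈ V ∩ {x : K | ‖π‖ ^ l * ‖x‖ < 1},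
        closedBall x (‖π‖ ^ l) ⊆ V ∩ {x : K | ‖π‖ ^ l * ‖x‖ < 1} := by
      rintro x ⟨hxV, hx⟩ s hs
      rw [mem_closedBall, dist_eq_norm] at hs
      refine ⟨?_, ?_⟩
      -- Either `s` is already far out, or `x` is in the bounded part, or `x` is far out and then so
      -- is `s`, a contradiction.
      · by_cases hsN : 1 ≤ ‖π‖ ^ (N : ℤ) * ‖s‖
        · exact hNR N le_rfl s hsN
        · by_cases hxN : x ∈ closedBall (0 : K) ((‖π‖ ^ N)⁻¹)
          · exact hL l hl1 x ⟨hxV, hxN⟩ (by simpa [dist_eq_norm] using hs)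
          · refine absurd ?_ hsN
            rw [mem_closedBall, dist_zero_right, not_le, inv_lt_iff_one_lt_mul₀ (by positivity)]
              at hxN
            have hpN : ‖π‖ ^ N ≤ 1 := pow_le_one₀ hπ.le hπ1.le
            have h1 : ‖s - x‖ < ‖x‖ := by
              have : 1 < ‖x‖ := by nlinarith [norm_nonneg x]
              linarith
            have h2 : ‖x‖ ≤ ‖s‖ := by
              have := IsUltrametricDist.norm_sub_le_max s (s - x)
              rw [sub_sub_cancel] at this
              rcases le_max_iff.mp this with h | h
              · exact h
              · linarith
            rw [zpow_natCast]
            have : 0 < ‖π‖ ^ N := by positivity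
            nlinarith
      · by_contra hs1
        simp only [Set.mem_ofPred_eq, not_lt] at hs1 hx
        exact absurd (hbig s x hs1 (by rwa [norm_sub_rev])) (not_le.mpr hx)
    -- A union of balls of a fixed radius is also closed: a point outside it has distance at least
    -- that radius from it.
    have hclosed : IsClosed (V ∩ {x : K | ‖π‖ ^ l * ‖x‖ < 1}) := by
      rw [← isOpen_compl_iff, Metric.isOpen_iff]
      intro x hx
      refine ⟨‖π‖ ^ l, hr, fun s hs hs' => hx (hopen s hs' ?_)⟩
      rw [mem_closedBall']
      exact (mem_ball.mp hs).le
    have hcomp : IsCompact (V ∩ {x : K | ‖π‖ ^ l * ‖x‖ < 1}) := by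
      refine (isCompact_closedBall (0 : K) (‖π‖ ^ l)⁻¹).of_isClosed_subset hclosed ?_
      rintro x ⟨-, hx⟩
      rw [mem_closedBall, dist_zero_right, ← one_div, le_div_iff₀ hr, mul_comm]
      exact hx.le
    refine nonempty_of_finite_part hπ hcomp hopen (Or.inr rfl) ?_ ?_
    · rw [Set.disjoint_right]
      rintro _ ⟨x, ⟨-, hx⟩, rfl⟩ hx'
      exact absurd (hx' x rfl) (not_le.mpr hx)
    · ext x
      induction x using OnePoint.rec with
      | infty => simp [hinf, projBall]
      | coe x =>
        have e : ((x : OnePoint K) ∈ projBall OnePoint.infty (‖π‖ ^ l)) ↔ 1 ≤ ‖π‖ ^ l * ‖x‖ := by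
          constructor
          · exact fun h => h x rfl
          · rintro h s hs
            rwa [← OnePoint.coe_injective hs]
        rw [Set.mem_union, e, OnePoint.coe_injective.mem_set_image]
        constructor
        · rintro (h | h)
          · exact hNR l hl2 x h
          · exact h.1
        · intro hx
          rcases le_or_gt 1 (‖π‖ ^ l * ‖x‖) with h | h
          · exact Or.inl h
          · exact Or.inr ⟨hx, h⟩
  · have hVS : ((↑) : K → OnePoint K) '' V = S := by
      ext x
      induction x using OnePoint.rec with
      | infty => simp [hinf]
      | coe x => simp [hV, OnePoint.coe_injective.mem_set_image]
    have hVcomp : IsCompact V := by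
      rw [OnePoint.isOpenEmbedding_coe.isInducing.isCompact_iff, hVS]
      exact hSc
    obtain ⟨L, hL⟩ := exists_radius_closedBall_subset hVcomp hVo subset_rfl hπ1 hπ
    exact ⟨L, fun l hl => nonempty_of_finite_part hπ hVcomp (hL l hl) (Or.inl rfl)
      (Set.empty_disjoint _) (by rw [Set.empty_union, hVS])⟩

end

end BallDecomposition

/-! ### The case of $k_\infty$ and $\mathbb C_\infty$. -/

instance CInfty.isUltrametricDist (Fq : Type*) [Field Fq] [Fintype Fq] :
    IsUltrametricDist (CInfty Fq) := by
  refine IsUltrametricDist.isUltrametricDist_of_forall_norm_add_le_max_norm fun x y => ?_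
  induction x, y using UniformSpace.Completion.induction_on₂ with
  | hp => exact isClosed_le (by fun_prop) (by fun_prop)
  | ih x y =>
    rw [← UniformSpace.Completion.coe_add]
    simp only [UniformSpace.Completion.norm_coe]
    exact IsUltrametricDist.norm_add_le_max x y

theorem mainTheorem2 (Fq : Type*) [Field Fq] [Fintype Fq] (h : ℕ)
    (S : Set (OnePoint (KInfty Fq))) (hSo : IsOpen S) (hSc : IsCompact S) :
    (∃ L : ℤ, ∀ l₀ ≥ L, Nonempty (BallDecomposition (KInfty.unif Fq) l₀ S)) ∧
    ∀ (l₀ : ℤ) (D : BallDecomposition (KInfty.unif Fq) l₀ S),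
      CompleteSpace (D.CnSpace (CInfty Fq) h) ∧
      ∃ hP : D.locPoly (CInfty Fq) h ≤ D.cnFunctions (CInfty Fq) h,
      ∃ E : (D.CnSpace (CInfty Fq) h →L[CInfty Fq] CInfty Fq) ≃ₗ[CInfty Fq]
          D.admissibleMeasures (CInfty Fq) h,
        (∀ (μ : D.CnSpace (CInfty Fq) h →L[CInfty Fq] CInfty Fq)
          (p : S → CInfty Fq) (hp : p ∈ D.locPoly (CInfty Fq) h),
          (E μ).1 ⟨p, hp⟩ = μ (BallDecomposition.CnSpace.mk p (hP hp))) ∧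
        ∀ (μ : D.CnSpace (CInfty Fq) h →L[CInfty Fq] CInfty Fq)
          (f : D.CnSpace (CInfty Fq) h) (T : ℤ → OnePoint (KInfty Fq) → Finset (KInfty Fq)),
          (∀ l ≥ l₀, D.IsSample l (T l)) →
          Filter.Tendsto (fun l => D.riemannSum l (T l) f.toFun (E μ).1) Filter.atTop
            (nhds (μ f)) := by
  have hπ : 0 < ‖KInfty.unif Fq‖ := by
    rw [KInfty.norm_unif, inv_pos]
    exact_mod_cast Fintype.card_pos
  have hπ1 : ‖KInfty.unif Fq‖ < 1 := by
    rw [KInfty.norm_unif]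
    exact inv_lt_one_of_one_lt₀ (by exact_mod_cast Fintype.one_lt_card)
  refine ⟨BallDecomposition.exists_forall_nonempty hπ hπ1 hSo hSc, fun l₀ D => ?_⟩
  exact ⟨D.completeSpace_cnSpace hπ, D.locPoly_le_cnFunctions hπ hπ1 h,
    LinearEquiv.ofBijective _ (D.bijective_restrictDual hπ hπ1), fun _ _ _ => rfl,
    fun μ f _ hT => D.tendsto_riemannSum hπ hπ1 μ f hT⟩
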